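/- Let $Y=\{y_k\}_{k\ge1}$, let $Y^*$ be the free monoid on $Y$, and let $\mathbb C\langle\langle Y\rangle\rangle$ be the noncommutative series $S=\sum_{w\in Y^*}\langle S|w\rangle w$. The weight of $w=y_{s_1}\cdots y_{s_k}$ is $s_1+\cdots+s_k$. For $S$ without constant term, $S^*=1+S+S^2+\cdots$ (concatenation powers). The shuffle $\sqcup\!\sqcup$ and the quasi-shuffle $\star$ are the bilinear products on series given on words by $1\star w=w\star 1=w$ and $$y_su\star y_tv=y_s(u\star y_tv)+y_t(y_su\star v)+y_{s+t}(u\star v),$$ the shuffle being given by the same rule without the last term. Infinite products of series, written $\mathop{\star}_{r\ge1}$ and $\mathop{\sqcup\!\sqcup}_{r\ge1}$ respectively, are limits of partial products, each coefficient being eventually constant. For a word $w=y_{s_1}\cdots y_{s_k}$ let $\mathrm H_w(n)=\sum_{n\ge n_1>\cdots>n_k>0}n_1^{-s_1}\cdots n_k^{-s_k}$, and let $\gamma_w$ be the finite part of $\mathrm H_w(n)$ as $n\to\infty$ in the scale $\{n^a\log^bn\}_{a\in\mathbb Z,b\in\mathbb N}$, i.e. the coefficient of $n^0\log^0n$. For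 $S\in\mathbb C\langle\langle Y\rangle\rangle$ let $S_n$ be the part of $S$ of weight $n$. We say $S\in\mathrm{Dom}(\gamma)$ if $\sum_{n\ge0}\gamma_{S_n}$ converges, where $\gamma_{S_n}=\sum_{w\text{ of weight }n}\langle S|w\rangle\gamma_w$, and then $\gamma_S:=\sum_{n\ge0}\gamma_{S_n}$. For $|z|<1$ put $\ell_1(z)=\gamma z-\sum_{k\ge2}\zeta(k)\frac{(-z)^k}{k}$ ($\gamma$ being Euler's constant), $\ell_r(z)=-\sum_{k\ge1}\zeta(kr)\frac{(-z^r)^k}{k}$ for $r\ge2$, and $\Gamma_{y_r}(1+z)=e^{-\ell_r(z)}$ for $r\ge1$. With the differential forms $\omega_r=(\partial\ell_r)\,dz$ on the unit disc, let $\alpha_0^z(y_{s_1}\cdots y_{s_k})=\int_0^z\omega_{s_1}(z_1)\int_0^{z_1}\omega_{s_2}(z_2)\cdots\int_0^{z_{k-1}}\omega_{s_k}(z_k)$ and $\alpha_0^z(S)=\sum_{w}\langle S|w\rangle\alpha_0^z(w)$ when this series converges absolutely. The finite part $\gamma_w$ exists for every word $w$, and the following holds. 1. Let $|z|<1$. The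 infinite products of series $\mathop{\star}\limits_{r\ge1}(z^ry_r)^*$ and $\mathop{\sqcup\!\sqcup}\limits_{r\ge1}y_r^*$ exist, the series $(z^ry_r)^*$ $(r\ge1)$ and $\mathop{\star}\limits_{r\ge1}(z^ry_r)^*$ belong to $\mathrm{Dom}(\gamma)$, the infinite products of numbers and the series $\alpha_0^z$ below converge unconditionally, and $$\gamma_{\mathop{\star}\limits_{r\ge1}(z^ry_r)^*}=\prod_{r\ge1}\gamma_{(z^ry_r)^*}=\prod_{r\ge1}e^{\ell_r(z)}=\prod_{r\ge1}\frac1{\Gamma_{y_r}(1+z)}=\alpha_0^z\Bigl(\mathop{\sqcup\!\sqcup}\limits_{r\ge1}\,y_r^*\Bigr).$$ 2. Let $(a_s)_{s\ge1},(b_s)_{s\ge1}$ be sequences of complex numbers. Then $$\gamma_{(\sum_{s\ge1}(a_s+b_s)y_s+\sum_{r,s\ge1}a_sb_ry_{s+r})^*}=\gamma_{(\sum_{s\ge1}a_sy_s)^*}\,\gamma_{(\sum_{s\ge1}b_sy_s)^*}$$ whenever the three series occurring in it belong to $\mathrm{Dom}(\gamma)$; and they do belong to $\mathrm{Dom}(\gamma)$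 if $\sum_s|a_s|<\infty$ and $\sum_s|b_s|<\infty$. In particular, for all $r,s\ge1$ and $c,d\in\mathbb C$, all series below belong to $\mathrm{Dom}(\gamma)$ and $$\gamma_{(c\,y_s+d\,y_r+cd\,y_{s+r})^*}=\gamma_{(c\,y_s)^*}\gamma_{(d\,y_r)^*},\qquad \gamma_{(-c^2y_{2s})^*}=\gamma_{(c\,y_s)^*}\gamma_{(-c\,y_s)^*}.$$ -/

import Mathlib

open Filter Topology

noncomputable section

namespace EulerianStars

/-- Words over the alphabet `Y = {y_k : k ≥ 1}`; the letter `y_k` is the positive integer `k`. -/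
abbrev Word : Type := List ℕ+

/-- Noncommutative formal power series over `Y` with complex coefficients:
`S w` is the coefficient of the word `w` in `S`. Sums and scalar multiples are coefficientwise;
the (pointwise) multiplication of functions is never used. -/
abbrev Series : Type := Word → ℂ

/-- The weight `s₁ + ⋯ + s_k` of the word `y_{s₁} ⋯ y_{s_k}`. -/
def weight (w : Word) : ℕ := (w.map PNat.val).sum

theorem finite_weight_eq (n : ℕ) : {w : Word | weight w = n}.Finite := by
  have hinj : Function.Injective (List.map PNat.val) :=
    List.map_injective_iff.mpr PNat.coe_injective
  refine Set.Finite.of_finite_image (f := List.map PNat.val) ?_ hinj.injOn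
  refine (Set.finite_range (fun c : Composition n => c.blocks)).subset ?_
  rintro _ ⟨w, hw, rfl⟩
  refine ⟨⟨w.map PNat.val, ?_, hw⟩, rfl⟩
  intro i hi
  obtain ⟨s, -, rfl⟩ := List.mem_map.mp hi
  exact s.pos

/-- The finite set of words of weight `n`. -/
def wordsOfWeight (n : ℕ) : Finset Word := (finite_weight_eq n).toFinset

/-! ### Concatenation, Kleene star -/

/-- The series `1`, that is, the empty word. -/
def oneSeries : Series := fun w => if w = [] then 1 else 0

/-- The concatenation (Cauchy) product: the sum over all factorizations `w = u v`. -/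
def conc (S T : Series) : Series := fun w =>
  ∑ i ∈ Finset.range (w.length + 1), S (w.take i) * T (w.drop i)

/-- Powers for the concatenation product. -/
def concPow (S : Series) : ℕ → Series
  | 0 => oneSeries
  | n + 1 => conc S (concPow S n)

/-- The Kleene star `S^* = 1 + S + S² + ⋯` of a series without constant term; for such a series
`S^n` has no word of length less than `n`, so that the sum stops at the length of the word. -/
def kleeneStar (S : Series) : Series := fun w =>
  ∑ n ∈ Finset.range (w.length + 1), concPow S n w

/-- The homogeneous series of degree one `∑_{s ≥ 1} a_s y_s`. -/
def letters (a : ℕ+ → ℂ) : Series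
  | [s] => a s
  | _ => 0

/-! ### Shuffle and quasi-shuffle products -/

/-- The words of the shuffle product of two words, listed with multiplicity. -/
def shuffleWords : Word → Word → List Word
  | [], v => [v]
  | a :: u, [] => [a :: u]
  | a :: u, b :: v =>
      (shuffleWords u (b :: v)).map (List.cons a) ++
      (shuffleWords (a :: u) v).map (List.cons b)
termination_by u v => u.length + v.length

/-- The words of the quasi-shuffle product of two words, listed with multiplicity. -/
def stuffleWords : Word → Word → List Word
  | [], v => [v]
  | a :: u, [] => [a :: u]
  | a :: u, b :: v =>
      (stuffleWords u (b :: v)).map (List.cons a) ++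
      (stuffleWords (a :: u) v).map (List.cons b) ++
      (stuffleWords u v).map (List.cons (a + b))
termination_by u v => u.length + v.length

/-- Bilinear extension to series of a product of words that preserves the weight. -/
def extendProduct (m : Word → Word → List Word) (S T : Series) : Series := fun w =>
  ∑ p ∈ Finset.HasAntidiagonal.antidiagonal (weight w), ∑ u ∈ wordsOfWeight p.1, ∑ v ∈ wordsOfWeight p.2,
    S u * T v * ((m u v).count w : ℂ)

/-- The shuffle product of two series. -/
def shuffle : Series → Series → Series := extendProduct shuffleWords

/-- The quasi-shuffle product of two series. -/
def stuffle : Series → Series → Series := extendProduct stuffleWords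

/-- The partial product `F 1 ⋆ F 2 ⋆ ⋯ ⋆ F k` for a product `⋆` of series. -/
def partialProduct (op : Series → Series → Series) (F : ℕ+ → Series) : ℕ → Series
  | 0 => oneSeries
  | k + 1 => op (partialProduct op F k) (F k.succPNat)

/-- `S` is the infinite product of the `F r`, `r ≥ 1`: every coefficient of the partial products
is eventually equal to that of `S`. -/
def IsInfiniteProduct (op : Series → Series → Series) (F : ℕ+ → Series) (S : Series) : Prop :=
  ∀ w : Word, ∀ᶠ k in atTop, partialProduct op F k w = S w

/-! ### Harmonic sums and the character `γ` -/

/-- The harmonic sum `H_{s₁,…,s_r}(n) = ∑_{n ≥ n₁ > ⋯ > n_r > 0} n₁^{-s₁} ⋯ n_r^{-s_r}`,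
summed first over `n₁ = m + 1`. -/
def harmonicSum : Word → ℕ → ℂ
  | [], _ => 1
  | s :: w, n => ∑ m ∈ Finset.range n, harmonicSum w m / ((m : ℂ) + 1) ^ (s : ℕ)

/-- `c` is the finite part of `f n` as `n → ∞` in the scale `n^a (log n)^b`, `a ∈ ℤ`, `b ∈ ℕ`:
up to a null sequence, `f` is a finite combination of functions of the scale, and `c` is the
coefficient of `n^0 (log n)^0`. -/
def HasFinitePart (f : ℕ → ℂ) (c : ℂ) : Prop :=
  ∃ C : (ℤ × ℕ) →₀ ℂ, C (0, 0) = c ∧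
    Tendsto (fun n : ℕ => f n -
      C.sum fun p k => k * ((n : ℂ) ^ p.1 * ((Real.log (n : ℝ) : ℝ) : ℂ) ^ p.2)) atTop (𝓝 0)

/-- `γ_w`, the finite part of the harmonic sum `H_w(n)`. -/
def gammaWord (w : Word) : ℂ := Classical.epsilon (HasFinitePart (harmonicSum w))

/-- The value of `γ` at the (polynomial) homogeneous component of weight `n` of `S`. -/
def gammaComponent (S : Series) (n : ℕ) : ℂ := ∑ w ∈ wordsOfWeight n, S w * gammaWord w

/-- The domain of `γ`: the series `S = ∑ₙ Sₙ`, `Sₙ` of weight `n`, for which `∑ₙ γ_{Sₙ}`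
converges. -/
def gammaDom : Set Series :=
  {S | ∃ c : ℂ, Tendsto (fun N => ∑ n ∈ Finset.range N, gammaComponent S n) atTop (𝓝 c)}

/-- `γ_S = ∑ₙ γ_{Sₙ}`, for `S` in the domain of `γ`. -/
def gammaSeries (S : Series) : ℂ :=
  limUnder atTop (fun N => ∑ n ∈ Finset.range N, gammaComponent S n)

/-! ### The functions `ℓ_r`, `Γ_{y_r}`, and iterated integrals -/

/-- `ℓ_1(z) = γ z - ∑_{k ≥ 2} ζ(k) (-z)^k / k` and
`ℓ_r(z) = -∑_{k ≥ 1} ζ(k r) (-z^r)^k / k` for `r ≥ 2` (where `|z| < 1`). -/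
def ell (r : ℕ+) (z : ℂ) : ℂ :=
  if r = 1 then
    (Real.eulerMascheroniConstant : ℂ) * z
      - ∑' k : ℕ, riemannZeta ((k : ℂ) + 2) * (-z) ^ (k + 2) / ((k : ℂ) + 2)
  else
    -∑' k : ℕ, riemannZeta (((k : ℂ) + 1) * ((r : ℕ) : ℂ)) * (-z ^ (r : ℕ)) ^ (k + 1)
      / ((k : ℂ) + 1)

/-- `Γ_{y_r}`, defined on the disc of centre `1` and radius `1` by
`Γ_{y_r}(1 + z) = exp (-ℓ_r(z))`. -/
def GammaY (r : ℕ+) (u : ℂ) : ℂ := Complex.exp (-ell r (u - 1))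

/-- The iterated integral `∫_0^z ω_{s₁}(z₁) ∫_0^{z₁} ω_{s₂}(z₂) ⋯` of the differential forms
`ω_s = (∂ℓ_s) dz` for the word `y_{s₁} y_{s₂} ⋯`, where `|z| < 1`. The forms are holomorphic on
the unit disc, so the path does not matter, and each integral is taken along a segment. -/
def alphaWord : Word → ℂ → ℂ
  | [], _ => 1
  | s :: w, z => ∫ t in (0 : ℝ)..1,
      deriv (ell s) ((t : ℂ) * z) * alphaWord w ((t : ℂ) * z) * z

/-- The coefficients of `∑_s (a_s + b_s) y_s + ∑_{r,s} a_s b_r y_{s+r}`. -/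
def starLaw (a b : ℕ+ → ℂ) : ℕ+ → ℂ := fun n =>
  a n + b n + ∑ p ∈ (Finset.Iio n ×ˢ Finset.Iio n).filter (fun p => p.1 + p.2 = n), a p.1 * b p.2

end EulerianStars

end

open EulerianStars

noncomputable section

namespace EulerianStars

/-! The coefficient of a word in the star of `∑ a_s y_s` is the product of the `a_s` over its
letters, and this multiplicativity is preserved by both products. Removing the first letter is a
derivation for the shuffle, and for the quasi-shuffle it has one extra term from merged letters
(`shuffle_cons`, `stuffle_cons`). Hence a shuffle of stars adds the letter series, while a
quasi-shuffle of stars multiplies the power series `A = 1 + ∑ a_s X^s`, which is what `starLaw`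
encodes. Partial products of the stars in the theorem stabilise in each weight, so the infinite
products exist and are again stars.

Graded by weight, the harmonic sums of a star form `∏_{1 ≤ m ≤ N} A(X/m)` (`coeff_harmonicSeries`),
which is multiplicative in `A` for every `N`. Each harmonic sum is a polynomial in `log N` up to
power decay (`LogExp.harmonicSum`). Taking the constant term of such an expansion respects sums and
products, and it equals the finite part because finite parts are unique. So the generating series
`gammaGen` of `γ` by weight is multiplicative (`gammaGen_starLaw`), and Abel's limit theorem carries
this over to the values of `γ` whenever the three series converge.

Convergence for `∑ |a_s| < ∞` comes from the ℓ¹ norm of coefficients. The factor `A(X) exp(-a_1 X)`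
is `1 + O(X²)`, so its rescalings by `1/m` have norm `1 + O(1/m²)` and their products stay bounded.
A bounded polynomial in `log N` is constant, so coefficients converge, and the ℓ¹ bound passes to
the limit (`sum_norm_coeff_normalizedLim_le`). The removed exponential contributes `exp(γ a_1 X)`.

For one letter, the normalised product is evaluated by expanding `log(1 + (z/m)^r)` and summing over
`m` first, which gives zeta values and `exp(ℓ_r(z))`. For the infinite quasi-shuffle product, the ℓ¹
bounds are uniform in the number of factors at a radius `ρ` with `|z| < ρ < 1`; rescaling by `z/ρ`
then gives geometric domination and the limit `exp(∑ ℓ_r(z))`. On the other side the shuffle product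
of all `y_r^*` has every coefficient equal to `1`. The iterated integrals of words of length `k` add
up to `(∑ ℓ_r(z))^k / k!`, hence all of them to the same exponential. -/

@[simp] theorem weight_nil : weight [] = 0 := rfl

@[simp] theorem weight_cons (s : ℕ+) (w : Word) : weight (s :: w) = (s : ℕ) + weight w := rfl

@[simp] theorem mem_wordsOfWeight {n : ℕ} {w : Word} : w ∈ wordsOfWeight n ↔ weight w = n := by
  simp [wordsOfWeight]

theorem weight_eq_zero {w : Word} (h : weight w = 0) : w = [] := by
  cases w with
  | nil => rfl
  | cons s w => have := s.pos; simp at h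

/-! ### Kleene stars of homogeneous series of degree one -/

theorem conc_letters_nil (a : ℕ+ → ℂ) (T : Series) : conc (letters a) T [] = 0 := by
  simp [conc, letters]

/-- Only the factorization that cuts after the first letter has a left factor of length one. -/
theorem conc_letters_cons (a : ℕ+ → ℂ) (T : Series) (s : ℕ+) (w : Word) :
    conc (letters a) T (s :: w) = a s * T w := by
  rw [conc, Finset.sum_eq_single 1]
  · simp [letters]
  · intro i hi h1
    match i with
    | 0 => simp [letters]
    | 1 => exact absurd rfl h1
    | i + 2 =>
      cases w with
      | nil => simp at hi
      | cons t w => simp [letters]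
  · simp

theorem concPow_letters (a : ℕ+ → ℂ) (n : ℕ) (w : Word) :
    concPow (letters a) n w = if w.length = n then (w.map a).prod else 0 := by
  induction n generalizing w with
  | zero => cases w <;> simp [concPow, oneSeries]
  | succ n ih =>
    cases w with
    | nil => simp [concPow, conc_letters_nil]
    | cons s w => simp [concPow, conc_letters_cons, ih]

theorem kleeneStar_letters (a : ℕ+ → ℂ) (w : Word) :
    kleeneStar (letters a) w = (w.map a).prod := by
  simp [kleeneStar, concPow_letters]

theorem kleeneStar_letters_cons (a : ℕ+ → ℂ) (s : ℕ+) (w : Word) :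
    kleeneStar (letters a) (s :: w) = a s * kleeneStar (letters a) w := by
  simp [kleeneStar_letters]

theorem kleeneStar_letters_nil (a : ℕ+ → ℂ) : kleeneStar (letters a) [] = 1 := by
  simp [kleeneStar_letters]

theorem kleeneStar_letters_zero : kleeneStar (letters 0) = oneSeries := by
  funext w
  cases w <;> simp [kleeneStar_letters, oneSeries]

/-- A series with constant term `1` all of whose left derivatives are multiples of it is a star. -/
theorem eq_kleeneStar_letters {S : Series} {a : ℕ+ → ℂ} (h0 : S [] = 1)
    (h : ∀ s w, S (s :: w) = a s * S w) : S = kleeneStar (letters a) := by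
  funext w
  induction w with
  | nil => rw [h0, kleeneStar_letters_nil]
  | cons s w ih => rw [h, kleeneStar_letters_cons, ih]

/-! ### Left derivatives of products of series -/

theorem count_map_cons (c a : ℕ+) (w : Word) (l : List Word) :
    (l.map (List.cons a)).count (c :: w) = if a = c then l.count w else 0 := by
  split_ifs with h
  · subst h
    exact List.count_map_of_injective l (List.cons a) (List.cons_injective) w
  · rw [List.count_eq_zero]
    simp [h]

theorem weight_of_mem_shuffleWords (u v : Word) :
    ∀ w ∈ shuffleWords u v, weight w = weight u + weight v := by
  induction u, v using shuffleWords.induct with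
  | case1 v => simp [shuffleWords]
  | case2 a u => simp [shuffleWords]
  | case3 a u b v ih1 ih2 =>
    intro w hw
    rw [shuffleWords] at hw
    simp only [List.mem_append, List.mem_map] at hw
    rcases hw with ⟨x, hx, rfl⟩ | ⟨x, hx, rfl⟩
    · simp [ih1 x hx]; ring
    · simp [ih2 x hx]; ring

theorem weight_of_mem_stuffleWords (u v : Word) :
    ∀ w ∈ stuffleWords u v, weight w = weight u + weight v := by
  induction u, v using stuffleWords.induct with
  | case1 v => simp [stuffleWords]
  | case2 a u => simp [stuffleWords]
  | case3 a u b v ih1 ih2 ih3 =>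
    intro w hw
    rw [stuffleWords] at hw
    simp only [List.mem_append, List.mem_map] at hw
    rcases hw with (⟨x, hx, rfl⟩ | ⟨x, hx, rfl⟩) | ⟨x, hx, rfl⟩
    · simp [ih1 x hx]; ring
    · simp [ih2 x hx]; ring
    · simp [ih3 x hx]; ring

/-- A product of series is a sum over all pairs of words. -/
theorem extendProduct_eq_tsum {m : Word → Word → List Word}
    (hm : ∀ u v, ∀ w ∈ m u v, weight w = weight u + weight v) (S T : Series) (w : Word) :
    HasSum (fun p : Word × Word => S p.1 * T p.2 * ((m p.1 p.2).count w : ℂ))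
      (extendProduct m S T w) := by
  have key : extendProduct m S T w =
      ∑ p ∈ (Finset.HasAntidiagonal.antidiagonal (weight w)).sigma
        (fun p => wordsOfWeight p.1 ×ˢ wordsOfWeight p.2),
        S p.2.1 * T p.2.2 * ((m p.2.1 p.2.2).count w : ℂ) := by
    rw [Finset.sum_sigma]
    simp only [Finset.sum_product]
    rfl
  -- The weights are determined by the two words, so the outer index can be forgotten injectively.
  have key2 : extendProduct m S T w =
      ∑ p ∈ ((Finset.HasAntidiagonal.antidiagonal (weight w)).sigma
        (fun p => wordsOfWeight p.1 ×ˢ wordsOfWeight p.2)).image (fun p => p.2),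
        S p.1 * T p.2 * ((m p.1 p.2).count w : ℂ) := by
    rw [key, Finset.sum_image]
    rintro ⟨⟨i, j⟩, u, v⟩ h ⟨⟨i', j'⟩, u', v'⟩ h' heq
    simp at h h' heq
    obtain ⟨rfl, rfl⟩ := heq
    simp [← h.2.1, ← h.2.2, ← h'.2.1, ← h'.2.2]
  rw [key2]
  apply hasSum_sum_of_ne_finset_zero
  rintro ⟨u, v⟩ h
  have : (m u v).count w = 0 := by
    rw [List.count_eq_zero]
    intro hw
    apply h
    simp only [Finset.mem_image, Finset.mem_sigma, Finset.mem_product, mem_wordsOfWeight]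
    exact ⟨⟨(weight u, weight v), (u, v)⟩,
      ⟨Finset.HasAntidiagonal.mem_antidiagonal.2 (hm u v w hw).symm, rfl, rfl⟩, rfl⟩
  simp [this]

/-- The number of occurrences of `w` in the products of the words starting with the letter `c`. -/
def tailCount (m : Word → Word → List Word) (c : ℕ+) (w : Word) : Word → Word → ℕ
  | [], _ => 0
  | a :: u, v => if a = c then (m u v).count w else 0

/-- The letter `c` comes from `u` or from `v`; exchanging the arguments of the product lets
`tailCount` describe both cases, including those with an empty word. -/
theorem count_shuffleWords_cons (c : ℕ+) (w u v : Word) :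
    (shuffleWords u v).count (c :: w) =
      tailCount shuffleWords c w u v + tailCount (fun x y => shuffleWords y x) c w v u := by
  match u, v with
  | [], [] => simp [shuffleWords, tailCount]
  | [], b :: v =>
    simp [shuffleWords, tailCount, List.count_singleton]
    by_cases h : b = c <;> simp [h]
  | a :: u, [] =>
    have : ∀ u : Word, shuffleWords u [] = [u] := by
      intro u; cases u <;> simp [shuffleWords]
    simp [this, tailCount, List.count_singleton]
    by_cases h : a = c <;> simp [h]
  | a :: u, b :: v =>
    rw [shuffleWords, List.count_append, count_map_cons, count_map_cons]
    rfl

/-- The contribution of the merged first letters to the coefficient of `c w`. -/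
def mergeCount (c : ℕ+) (w : Word) : Word → Word → ℕ
  | a :: u, b :: v => if a + b = c then (stuffleWords u v).count w else 0
  | _, _ => 0

theorem count_stuffleWords_cons (c : ℕ+) (w u v : Word) :
    (stuffleWords u v).count (c :: w) =
      tailCount stuffleWords c w u v + tailCount (fun x y => stuffleWords y x) c w v u
        + mergeCount c w u v := by
  match u, v with
  | [], [] => simp [stuffleWords, tailCount, mergeCount]
  | [], b :: v =>
    simp [stuffleWords, tailCount, List.count_singleton, mergeCount]
    by_cases h : b = c <;> simp [h]
  | a :: u, [] =>
    have : ∀ u : Word, stuffleWords u [] = [u] := by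
      intro u; cases u <;> simp [stuffleWords]
    simp [this, tailCount, List.count_singleton, mergeCount]
    by_cases h : a = c <;> simp [h]
  | a :: u, b :: v =>
    rw [stuffleWords, List.count_append, List.count_append, count_map_cons, count_map_cons,
      count_map_cons]
    rfl

/-- The terms live on pairs whose left word starts with `c`, so the sum is reindexed by the tail of
that word. -/
theorem hasSum_tailCount_left {m : Word → Word → List Word}
    (hm : ∀ u v, ∀ w ∈ m u v, weight w = weight u + weight v) (S T : Series) (c : ℕ+) (w : Word) :
    HasSum (fun p : Word × Word => S p.1 * T p.2 * (tailCount m c w p.1 p.2 : ℂ))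
      (extendProduct m (fun u => S (c :: u)) T w) := by
  have h := extendProduct_eq_tsum hm (fun u => S (c :: u)) T w
  have hinj : Function.Injective (fun p : Word × Word => (c :: p.1, p.2)) := by
    rintro ⟨u, v⟩ ⟨u', v'⟩ h
    simpa using h
  rw [← hinj.hasSum_iff]
  · convert h using 2 with p
    simp [tailCount]
  · rintro ⟨u, v⟩ hu
    cases u with
    | nil => simp [tailCount]
    | cons a u =>
      have : a ≠ c := by rintro rfl; exact hu ⟨(u, v), rfl⟩
      simp [tailCount, this]

theorem hasSum_tailCount_right {m : Word → Word → List Word}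
    (hm : ∀ u v, ∀ w ∈ m u v, weight w = weight u + weight v) (S T : Series) (c : ℕ+) (w : Word) :
    HasSum (fun p : Word × Word => S p.1 * T p.2 *
        (tailCount (fun x y => m y x) c w p.2 p.1 : ℂ))
      (extendProduct m S (fun v => T (c :: v)) w) := by
  have h := extendProduct_eq_tsum hm S (fun u => T (c :: u)) w
  have hinj : Function.Injective (fun p : Word × Word => (p.1, c :: p.2)) := by
    rintro ⟨u, v⟩ ⟨u', v'⟩ h
    simpa using h
  rw [← hinj.hasSum_iff]
  · convert h using 2 with p
    simp [tailCount]
  · rintro ⟨u, v⟩ hu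
    cases v with
    | nil => simp [tailCount]
    | cons a v =>
      have : a ≠ c := by rintro rfl; exact hu ⟨(u, v), rfl⟩
      simp [tailCount, this]

/-- A merged first letter `c` arises from finitely many decompositions `c = a + b`; the pairs of
words are sorted by their first letters `(a, b)`. -/
theorem hasSum_mergeCount (S T : Series) (c : ℕ+) (w : Word) :
    HasSum (fun p : Word × Word => S p.1 * T p.2 * (mergeCount c w p.1 p.2 : ℂ))
      (∑ q ∈ (Finset.Iio c ×ˢ Finset.Iio c).filter (fun q => q.1 + q.2 = c),
        stuffle (fun u => S (q.1 :: u)) (fun v => T (q.2 :: v)) w) := by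
  set F := (Finset.Iio c ×ˢ Finset.Iio c).filter (fun q => q.1 + q.2 = c) with hF
  have h : ∀ q ∈ F, HasSum (fun p : Word × Word =>
      if p.1.head? = some q.1 ∧ p.2.head? = some q.2 then
        S p.1 * T p.2 * ((stuffleWords p.1.tail p.2.tail).count w : ℂ) else 0)
      (stuffle (fun u => S (q.1 :: u)) (fun v => T (q.2 :: v)) w) := by
    intro q _
    have h := extendProduct_eq_tsum weight_of_mem_stuffleWords
      (fun u => S (q.1 :: u)) (fun u => T (q.2 :: u)) w
    have hinj : Function.Injective (fun p : Word × Word => (q.1 :: p.1, q.2 :: p.2)) := by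
      rintro ⟨u, v⟩ ⟨u', v'⟩ h
      simpa using h
    rw [stuffle, ← hinj.hasSum_iff]
    · convert h using 2 with p
      simp
    · rintro ⟨u, v⟩ hu
      cases u with
      | nil => simp
      | cons a u =>
        cases v with
        | nil => simp
        | cons b v =>
          rw [if_neg]
          rintro ⟨h1, h2⟩
          simp at h1 h2
          exact hu ⟨(u, v), by simp [h1, h2]⟩
  convert hasSum_sum h using 2 with p
  obtain ⟨u, v⟩ := p
  cases u with
  | nil => simp [mergeCount]
  | cons a u =>
    cases v with
    | nil => simp [mergeCount]
    | cons b v =>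
      by_cases hc : a + b = c
      · have hmem : (a, b) ∈ F := by
          simp only [hF, Finset.mem_filter, Finset.mem_product, Finset.mem_Iio]
          refine ⟨⟨?_, ?_⟩, hc⟩ <;> rw [← hc]
          · exact PNat.lt_add_right a b
          · exact PNat.lt_add_left b a
        rw [Finset.sum_eq_single_of_mem (a, b) hmem]
        · simp [mergeCount, hc]
        · rintro ⟨a', b'⟩ _ hne
          rw [if_neg]
          rintro ⟨h1, h2⟩
          simp at h1 h2
          exact hne (by rw [h1, h2])
      · rw [Finset.sum_eq_zero]
        · simp [mergeCount, hc]
        · rintro ⟨a', b'⟩ hq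
          rw [if_neg]
          rintro ⟨h1, h2⟩
          simp at h1 h2
          simp [hF] at hq
          exact hc (by rw [h1, h2]; exact hq.2)

/-- Leibniz rule: left division by a letter is a derivation for the shuffle. -/
theorem shuffle_cons (S T : Series) (c : ℕ+) (w : Word) :
    shuffle S T (c :: w) =
      shuffle (fun u => S (c :: u)) T w + shuffle S (fun v => T (c :: v)) w := by
  refine (extendProduct_eq_tsum weight_of_mem_shuffleWords S T (c :: w)).unique ?_
  simp only [shuffle]
  convert (hasSum_tailCount_left weight_of_mem_shuffleWords S T c w).add
    (hasSum_tailCount_right weight_of_mem_shuffleWords S T c w) using 2 with p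
  rw [count_shuffleWords_cons]
  push_cast
  ring

/-- Leibniz rule with a correction for the letters `c = a + b` produced by merging. -/
theorem stuffle_cons (S T : Series) (c : ℕ+) (w : Word) :
    stuffle S T (c :: w) =
      stuffle (fun u => S (c :: u)) T w + stuffle S (fun v => T (c :: v)) w +
      ∑ q ∈ (Finset.Iio c ×ˢ Finset.Iio c).filter (fun q => q.1 + q.2 = c),
        stuffle (fun u => S (q.1 :: u)) (fun v => T (q.2 :: v)) w := by
  refine (extendProduct_eq_tsum weight_of_mem_stuffleWords S T (c :: w)).unique ?_
  convert ((hasSum_tailCount_left weight_of_mem_stuffleWords S T c w).add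
    (hasSum_tailCount_right weight_of_mem_stuffleWords S T c w)).add
    (hasSum_mergeCount S T c w) using 1
  · funext p
    rw [count_stuffleWords_cons]
    push_cast
    ring
  · rfl

theorem wordsOfWeight_zero : wordsOfWeight 0 = {[]} := by
  ext w
  simp only [mem_wordsOfWeight, Finset.mem_singleton]
  exact ⟨weight_eq_zero, fun h => by simp [h]⟩

theorem extendProduct_nil (m : Word → Word → List Word) (hm : m [] [] = [[]]) (S T : Series) :
    extendProduct m S T [] = S [] * T [] := by
  simp [extendProduct, wordsOfWeight_zero, hm]

theorem extendProduct_mul_left (m : Word → Word → List Word) (x : ℂ) (S T : Series) (w : Word) :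
    extendProduct m (fun u => x * S u) T w = x * extendProduct m S T w := by
  simp only [extendProduct, Finset.mul_sum, mul_assoc]

theorem extendProduct_mul_right (m : Word → Word → List Word) (x : ℂ) (S T : Series) (w : Word) :
    extendProduct m S (fun u => x * T u) w = x * extendProduct m S T w := by
  simp only [extendProduct, Finset.mul_sum]
  refine Finset.sum_congr rfl fun _ _ => Finset.sum_congr rfl fun _ _ =>
    Finset.sum_congr rfl fun _ _ => by ring

theorem shuffle_kleeneStar (a b : ℕ+ → ℂ) :
    shuffle (kleeneStar (letters a)) (kleeneStar (letters b)) = kleeneStar (letters (a + b)) := by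
  apply eq_kleeneStar_letters
  · rw [shuffle, extendProduct_nil _ (by simp [shuffleWords])]
    simp [kleeneStar_letters_nil]
  · intro s w
    rw [shuffle_cons]
    simp only [kleeneStar_letters_cons, shuffle, extendProduct_mul_left, extendProduct_mul_right,
      Pi.add_apply]
    ring

/-- Stars are eigenvectors of all left divisions, so the Leibniz rule shows that the product is one
too, with eigenvalues `starLaw a b`. -/
theorem stuffle_kleeneStar (a b : ℕ+ → ℂ) :
    stuffle (kleeneStar (letters a)) (kleeneStar (letters b)) =
      kleeneStar (letters (starLaw a b)) := by
  apply eq_kleeneStar_letters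
  · rw [stuffle, extendProduct_nil _ (by simp [stuffleWords])]
    simp [kleeneStar_letters_nil]
  · intro s w
    rw [stuffle_cons]
    simp only [kleeneStar_letters_cons, stuffle, extendProduct_mul_left, extendProduct_mul_right,
      starLaw, add_mul, Finset.sum_mul, mul_assoc, mul_left_comm (a _) (b _)]

/-! ### Infinite products of stars -/

/-- A letter of `w` never exceeds the weight of `w`; this is why coefficients of infinite products
stabilise. -/
theorem kleeneStar_letters_congr {a b : ℕ+ → ℂ} {w : Word}
    (h : ∀ s : ℕ+, (s : ℕ) ≤ weight w → a s = b s) :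
    kleeneStar (letters a) w = kleeneStar (letters b) w := by
  induction w with
  | nil => simp [kleeneStar_letters_nil]
  | cons s w ih =>
    rw [kleeneStar_letters_cons, kleeneStar_letters_cons, h s (by simp),
      ih (fun t ht => h t (by simp; omega))]

/-- Partial products of stars for the shuffle product. -/
theorem partialProduct_shuffle (c : ℕ+ → ℂ) (k : ℕ) :
    partialProduct shuffle (fun r => kleeneStar (letters (Pi.single r (c r)))) k =
      kleeneStar (letters (fun s => if (s : ℕ) ≤ k then c s else 0)) := by
  induction k with
  | zero =>
    have : (fun s : ℕ+ => if (s : ℕ) ≤ 0 then c s else 0) = 0 := by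
      funext s; have := s.pos; simp
    rw [this, kleeneStar_letters_zero]; rfl
  | succ k ih =>
    rw [partialProduct, ih, shuffle_kleeneStar]
    congr 2
    funext s
    by_cases h : s = k.succPNat
    · subst h
      simp
    · have h' : (s : ℕ) ≠ k + 1 := fun e => h (PNat.coe_injective (by simpa using e))
      have : ((s : ℕ) ≤ k + 1) ↔ ((s : ℕ) ≤ k) := by omega
      simp [h, this]

theorem isInfiniteProduct_shuffle (c : ℕ+ → ℂ) :
    IsInfiniteProduct shuffle (fun r => kleeneStar (letters (Pi.single r (c r))))
      (kleeneStar (letters c)) := by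
  intro w
  filter_upwards [eventually_ge_atTop (weight w)] with k hk
  rw [partialProduct_shuffle]
  exact kleeneStar_letters_congr fun s hs => by simp [hs.trans hk]

/-- The coefficients of the partial products `∏_{r ≤ k} (1 + c_r x^r)`. -/
def starLawProd (c : ℕ+ → ℂ) : ℕ → ℕ+ → ℂ
  | 0 => 0
  | k + 1 => starLaw (starLawProd c k) (Pi.single k.succPNat (c k.succPNat))

theorem partialProduct_stuffle (c : ℕ+ → ℂ) (k : ℕ) :
    partialProduct stuffle (fun r => kleeneStar (letters (Pi.single r (c r)))) k =
      kleeneStar (letters (starLawProd c k)) := by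
  induction k with
  | zero => rw [starLawProd, kleeneStar_letters_zero]; rfl
  | succ k ih => rw [partialProduct, ih, stuffle_kleeneStar, starLawProd]

/-- Multiplication by `1 + c x^(k+1)` does not affect the degrees up to `k`. -/
theorem starLawProd_succ_apply (c : ℕ+ → ℂ) (k : ℕ) (s : ℕ+) (hs : (s : ℕ) ≤ k) :
    starLawProd c (k + 1) s = starLawProd c k s := by
  have h : ∀ t : ℕ+, (t : ℕ) ≤ k → t ≠ k.succPNat := by
    rintro t ht rfl
    simp at ht
  rw [starLawProd, starLaw, Pi.single_eq_of_ne (h s hs), Finset.sum_eq_zero, add_zero, add_zero]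
  rintro ⟨p, q⟩ hp
  simp only [Finset.mem_filter, Finset.mem_product, Finset.mem_Iio] at hp
  have : (q : ℕ) < s := hp.1.2
  rw [Pi.single_eq_of_ne (h q (by omega)), mul_zero]

theorem starLawProd_apply_of_le (c : ℕ+ → ℂ) (s : ℕ+) {k : ℕ} (hk : (s : ℕ) ≤ k) :
    starLawProd c k s = starLawProd c s s := by
  induction k, hk using Nat.le_induction with
  | base => rfl
  | succ k hk ih => rw [starLawProd_succ_apply c k s hk, ih]

/-- The coefficients of the infinite product `∏_r (1 + c_r x^r)`. -/
def starLawLim (c : ℕ+ → ℂ) (s : ℕ+) : ℂ := starLawProd c s s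

theorem isInfiniteProduct_stuffle (c : ℕ+ → ℂ) :
    IsInfiniteProduct stuffle (fun r => kleeneStar (letters (Pi.single r (c r))))
      (kleeneStar (letters (starLawLim c))) := by
  intro w
  filter_upwards [eventually_ge_atTop (weight w)] with k hk
  rw [partialProduct_stuffle]
  exact kleeneStar_letters_congr fun s hs => starLawProd_apply_of_le c s (hs.trans hk)

/-! ### Sequences that decay like a negative power -/

/-- `e n = O((n + 1)^{-δ})` for some `δ > 0`. -/
def Small (e : ℕ → ℂ) : Prop :=
  ∃ δ > (0 : ℝ), ∃ C : ℝ, ∀ n : ℕ, ‖e n‖ ≤ C * ((n : ℝ) + 1) ^ (-δ)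

/-- The sequence `log n`. -/
def logSeq (n : ℕ) : ℂ := ((Real.log (n : ℝ) : ℝ) : ℂ)

namespace Small

theorem congr {e f : ℕ → ℂ} (he : Small e) (h : ∀ n, f n = e n) : Small f := by
  rwa [show f = e from funext h]

theorem zero : Small (fun _ => 0) := ⟨1, one_pos, 0, by simp⟩

theorem nonneg_const {e : ℕ → ℂ} {δ C : ℝ} (h : ∀ n : ℕ, ‖e n‖ ≤ C * ((n : ℝ) + 1) ^ (-δ)) :
    0 ≤ C := by
  have := (norm_nonneg _).trans (h 0)
  simpa using this

theorem mono {e : ℕ → ℂ} {δ δ' C : ℝ} (hδ : δ' ≤ δ)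
    (h : ∀ n : ℕ, ‖e n‖ ≤ C * ((n : ℝ) + 1) ^ (-δ)) (n : ℕ) :
    ‖e n‖ ≤ C * ((n : ℝ) + 1) ^ (-δ') := by
  refine (h n).trans (mul_le_mul_of_nonneg_left ?_ (nonneg_const h))
  exact Real.rpow_le_rpow_of_exponent_le (by simp) (by linarith)

theorem add {e f : ℕ → ℂ} (he : Small e) (hf : Small f) : Small (fun n => e n + f n) := by
  obtain ⟨δ, hδ, C, hC⟩ := he
  obtain ⟨δ', hδ', C', hC'⟩ := hf
  refine ⟨min δ δ', lt_min hδ hδ', C + C', fun n => (norm_add_le _ _).trans ?_⟩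
  rw [add_mul]
  exact add_le_add (mono (min_le_left _ _) hC n) (mono (min_le_right _ _) hC' n)

theorem mul {e f : ℕ → ℂ} (he : Small e) (hf : Small f) : Small (fun n => e n * f n) := by
  obtain ⟨δ, hδ, C, hC⟩ := he
  obtain ⟨δ', hδ', C', hC'⟩ := hf
  refine ⟨δ + δ', add_pos hδ hδ', C * C', fun n => ?_⟩
  rw [norm_mul, neg_add, Real.rpow_add (by positivity), mul_mul_mul_comm]
  exact mul_le_mul (hC n) (hC' n) (norm_nonneg _) ((norm_nonneg _).trans (hC n))

theorem const_mul {e : ℕ → ℂ} (he : Small e) (c : ℂ) : Small (fun n => c * e n) := by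
  obtain ⟨δ, hδ, C, hC⟩ := he
  refine ⟨δ, hδ, ‖c‖ * C, fun n => ?_⟩
  rw [norm_mul, mul_assoc]
  exact mul_le_mul_of_nonneg_left (hC n) (norm_nonneg _)

theorem mul_logSeq {e : ℕ → ℂ} (he : Small e) : Small (fun n => e n * logSeq n) := by
  obtain ⟨δ, hδ, C, hC⟩ := he
  refine ⟨δ / 2, by positivity, C * (δ / 2)⁻¹, fun n => ?_⟩
  have h0 : (0 : ℝ) < (n : ℝ) + 1 := by positivity
  -- Half of the decay exponent is spent on absorbing the logarithm.
  have h1 : ‖logSeq n‖ ≤ ((n : ℝ) + 1) ^ (δ / 2) / (δ / 2) := by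
    rw [logSeq, Complex.norm_real, Real.norm_of_nonneg (Real.log_natCast_nonneg n)]
    refine le_trans ?_ (Real.log_le_rpow_div h0.le (by positivity))
    rcases Nat.eq_zero_or_pos n with rfl | hn
    · simp
    · exact Real.log_le_log (by exact_mod_cast hn) (by linarith)
  rw [norm_mul]
  calc ‖e n‖ * ‖logSeq n‖
      ≤ (C * ((n : ℝ) + 1) ^ (-δ)) * (((n : ℝ) + 1) ^ (δ / 2) / (δ / 2)) :=
        mul_le_mul (hC n) h1 (norm_nonneg _) ((norm_nonneg _).trans (hC n))
    _ = C * (δ / 2)⁻¹ * (((n : ℝ) + 1) ^ (-δ) * ((n : ℝ) + 1) ^ (δ / 2)) := by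
        rw [div_eq_mul_inv]; ring
    _ = C * (δ / 2)⁻¹ * ((n : ℝ) + 1) ^ (-(δ / 2)) := by
        rw [← Real.rpow_add h0]; congr 2; ring

theorem mul_logSeq_pow {e : ℕ → ℂ} (he : Small e) (k : ℕ) :
    Small (fun n => e n * logSeq n ^ k) := by
  induction k with
  | zero => exact he.congr fun n => by simp
  | succ k ih => exact ih.mul_logSeq.congr fun n => by ring

theorem finset_sum {ι : Type*} (s : Finset ι) {e : ι → ℕ → ℂ} (h : ∀ i ∈ s, Small (e i)) :
    Small (fun n => ∑ i ∈ s, e i n) := by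
  classical
  induction s using Finset.induction_on with
  | empty => simpa using zero
  | insert i s hi ih =>
    refine ((h i (by simp)).add (ih fun j hj => h j (by simp [hj]))).congr fun n => ?_
    rw [Finset.sum_insert hi]

theorem mul_poly {e : ℕ → ℂ} (he : Small e) (P : Polynomial ℂ) :
    Small (fun n => e n * P.eval (logSeq n)) := by
  refine (finset_sum P.support fun k _ => (he.mul_logSeq_pow k).const_mul (P.coeff k)).congr
    fun n => ?_
  rw [Polynomial.eval_eq_sum, Polynomial.sum, Finset.mul_sum]
  exact Finset.sum_congr rfl fun k _ => by ring

theorem tendsto {e : ℕ → ℂ} (he : Small e) : Tendsto e atTop (𝓝 0) := by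
  obtain ⟨δ, hδ, C, hC⟩ := he
  refine squeeze_zero_norm hC ?_
  have h : Tendsto (fun n : ℕ => (n : ℝ) + 1) atTop atTop :=
    tendsto_atTop_add_const_right _ _ tendsto_natCast_atTop_atTop
  simpa using ((tendsto_rpow_neg_atTop hδ).comp h).const_mul C

theorem inv_succ : Small (fun n => ((n : ℂ) + 1)⁻¹) := by
  refine ⟨1, one_pos, 1, fun n => le_of_eq ?_⟩
  rw [Real.rpow_neg_one, norm_inv, one_mul]
  congr 1
  exact_mod_cast Complex.norm_natCast (n + 1)

/-- Summation of a sequence of power decay against `1 / (m + 1)`. -/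
theorem sum_div {e : ℕ → ℂ} (he : Small e) :
    ∃ c : ℂ, Small (fun N => ∑ m ∈ Finset.range N, e m / ((m : ℂ) + 1) - c) := by
  obtain ⟨δ, hδ, C, hC⟩ := he
  have hbound : ∀ m : ℕ, ‖e m / ((m : ℂ) + 1)‖ ≤ C * ((m : ℝ) + 1) ^ (-1 - δ) := by
    intro m
    have : ‖(m : ℂ) + 1‖ = (m : ℝ) + 1 := by exact_mod_cast Complex.norm_natCast (m + 1)
    have h0 : (0 : ℝ) < (m : ℝ) + 1 := by positivity
    rw [norm_div, this, sub_eq_add_neg, add_comm (-1), Real.rpow_add h0, Real.rpow_neg_one, ← mul_assoc]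
    exact div_le_div_of_nonneg_right (hC m) h0.le
  have hs : Summable (fun m : ℕ => ((m : ℝ) + 1) ^ (-1 - δ / 2)) := by
    have := (summable_nat_add_iff 1).2 (Real.summable_nat_rpow.2 (by linarith : -1 - δ / 2 < -1))
    exact_mod_cast this
  set K := ∑' m : ℕ, ((m : ℝ) + 1) ^ (-1 - δ / 2)
  have hC0 := nonneg_const hC
  have hle : ∀ N m : ℕ, ‖e (m + N) / (((m + N : ℕ) : ℂ) + 1)‖ ≤
      C * ((N : ℝ) + 1) ^ (-(δ / 2)) * ((m : ℝ) + 1) ^ (-1 - δ / 2) := by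
    intro N m
    refine (hbound (m + N)).trans ?_
    rw [mul_assoc]
    refine mul_le_mul_of_nonneg_left ?_ hC0
    -- Half of the decay goes to the rate of the tail in `N`; the other half keeps the series over
    -- `m` summable.
    rw [show -1 - δ = -(δ / 2) + (-1 - δ / 2) by ring, Real.rpow_add (by positivity)]
    push_cast
    refine mul_le_mul ?_ ?_ (by positivity) (by positivity)
    · exact Real.rpow_le_rpow_of_nonpos (by positivity) (by simp) (by linarith)
    · exact Real.rpow_le_rpow_of_nonpos (by positivity) (by simp) (by linarith)
  have hsum : Summable (fun m : ℕ => e m / ((m : ℂ) + 1)) := by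
    refine Summable.of_norm_bounded (hs.mul_left (C * ((0 : ℕ) + 1 : ℝ) ^ (-(δ / 2)))) fun m => ?_
    exact hle 0 m
  refine ⟨∑' m : ℕ, e m / ((m : ℂ) + 1), δ / 2, by positivity, C * K, fun N => ?_⟩
  beta_reduce
  rw [← hsum.sum_add_tsum_nat_add N, sub_add_cancel_left, norm_neg]
  refine (tsum_of_norm_bounded (hs.hasSum.mul_left (C * ((N : ℝ) + 1) ^ (-(δ / 2))))
    fun m => hle N m).trans (le_of_eq ?_)
  ring

end Small

theorem norm_logSeq (n : ℕ) : ‖logSeq n‖ = Real.log n := by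
  rw [logSeq, Complex.norm_real, Real.norm_of_nonneg (Real.log_natCast_nonneg n)]

theorem logSeq_zero : logSeq 0 = 0 := by simp [logSeq]

theorem log_succ_sub_log_bounds (m : ℕ) (hm : 0 < m) :
    1 / ((m : ℝ) + 1) ≤ Real.log ((m : ℝ) + 1) - Real.log m ∧
      Real.log ((m : ℝ) + 1) - Real.log m ≤ 1 / (m : ℝ) := by
  have h0 : (0 : ℝ) < m := by exact_mod_cast hm
  have h1 : (0 : ℝ) < (m : ℝ) + 1 := by positivity
  rw [← Real.log_div h1.ne' h0.ne']
  have h2 : (0 : ℝ) < ((m : ℝ) + 1) / m := by positivity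
  constructor
  · refine le_trans (le_of_eq ?_) (Real.one_sub_inv_le_log_of_pos h2)
    field_simp
    ring
  · refine (Real.log_le_sub_one_of_pos h2).trans (le_of_eq ?_)
    field_simp
    ring

theorem small_logSeq_diff : Small (fun m => ((m : ℂ) + 1) * (logSeq (m + 1) - logSeq m) - 1) := by
  refine ⟨1, one_pos, 2, fun m => ?_⟩
  have h1 : (0 : ℝ) < (m : ℝ) + 1 := by positivity
  rw [Real.rpow_neg_one]
  have : ((m : ℂ) + 1) * (logSeq (m + 1) - logSeq m) - 1 =
      ((((m : ℝ) + 1) * (Real.log ((m : ℝ) + 1) - Real.log m) - 1 : ℝ) : ℂ) := by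
    simp [logSeq]
  beta_reduce
  rw [this, Complex.norm_real, Real.norm_eq_abs]
  -- At `m = 0` the convention `Real.log 0 = 0` makes the expression `-1`, which the constant `2`
  -- covers.
  rcases Nat.eq_zero_or_pos m with rfl | hm
  · simp
  · obtain ⟨ha, hb⟩ := log_succ_sub_log_bounds m hm
    have h0 : (1 : ℝ) ≤ m := by exact_mod_cast hm
    have ha' := mul_le_mul_of_nonneg_left ha h1.le
    have hb' := mul_le_mul_of_nonneg_left hb h1.le
    rw [mul_one_div_cancel h1.ne'] at ha'
    rw [abs_of_nonneg (by linarith)]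
    have : ((m : ℝ) + 1) * (1 / m) - 1 ≤ 2 * ((m : ℝ) + 1)⁻¹ := by
      rw [← sub_nonneg]
      have : 2 * ((m : ℝ) + 1)⁻¹ - (((m : ℝ) + 1) * (1 / m) - 1) = (m - 1) / (m * (m + 1)) := by
        field_simp
        ring
      rw [this]
      apply div_nonneg <;> nlinarith
    linarith

theorem small_logSeq_succ_sub : Small (fun m => logSeq (m + 1) - logSeq m) := by
  refine ((Small.inv_succ.mul small_logSeq_diff).add Small.inv_succ).congr fun m => ?_
  have : (m : ℂ) + 1 ≠ 0 := by exact_mod_cast Nat.succ_ne_zero m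
  field_simp
  ring

/-- Discrete form of `x (log^k x)' = k log^(k-1) x`, obtained by induction from the product rule for
differences. -/
theorem small_logSeq_pow_diff (k : ℕ) : Small (fun m =>
    ((m : ℂ) + 1) * (logSeq (m + 1) ^ k - logSeq m ^ k) - k * logSeq m ^ (k - 1)) := by
  induction k with
  | zero => exact Small.zero.congr fun m => by simp
  | succ k ih =>
    refine (((ih.mul_logSeq.add (ih.mul small_logSeq_succ_sub)).add
      ((small_logSeq_succ_sub.mul_logSeq_pow (k - 1)).const_mul k)).add
      (small_logSeq_diff.mul_logSeq_pow k)).congr fun m => ?_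
    -- The subtraction in `k - 1` is truncated, so `k = 0` is separate; there the factor `k` cancels
    -- the term.
    rcases k with _ | k
    · simp
    · push_cast
      ring

/-- Discrete form of `∫ log^k x / x dx`: the differences of `log^(k+1)` telescope and their errors
sum to a constant plus a decaying tail. -/
theorem sum_logSeq_pow_div (k : ℕ) : ∃ c : ℂ, Small (fun N =>
    ∑ m ∈ Finset.range N, logSeq m ^ k / ((m : ℂ) + 1) - (logSeq N ^ (k + 1) / (k + 1) - c)) := by
  obtain ⟨c, hc⟩ := (small_logSeq_pow_diff (k + 1)).sum_div
  have hk : (k : ℂ) + 1 ≠ 0 := by exact_mod_cast Nat.succ_ne_zero k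
  refine ⟨c / (k + 1), (hc.const_mul (-1 / (k + 1))).congr fun N => ?_⟩
  have : ∑ m ∈ Finset.range N, (((m : ℂ) + 1) * (logSeq (m + 1) ^ (k + 1) - logSeq m ^ (k + 1)) -
      ((k + 1 : ℕ) : ℂ) * logSeq m ^ (k + 1 - 1)) / ((m : ℂ) + 1) =
      logSeq N ^ (k + 1) - (k + 1) * ∑ m ∈ Finset.range N, logSeq m ^ k / ((m : ℂ) + 1) := by
    have htel := Finset.sum_range_sub (fun m => logSeq m ^ (k + 1)) N
    simp only [logSeq_zero, ne_eq, Nat.succ_ne_zero, not_false_eq_true, zero_pow, sub_zero] at htel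
    rw [← htel, Finset.mul_sum, ← Finset.sum_sub_distrib]
    refine Finset.sum_congr rfl fun m _ => ?_
    have : (m : ℂ) + 1 ≠ 0 := by exact_mod_cast Nat.succ_ne_zero m
    push_cast
    field_simp
  rw [this]
  field_simp
  ring

/-! ### Expansions in powers of the logarithm -/

/-- `f n` is a polynomial in `log n` with constant term `c`, up to an error of power decay. -/
def LogExp (f : ℕ → ℂ) (c : ℂ) : Prop :=
  ∃ P : Polynomial ℂ, P.coeff 0 = c ∧ Small (fun n => f n - P.eval (logSeq n))

namespace LogExp

theorem congr {f g : ℕ → ℂ} {c : ℂ} (hf : LogExp f c) (h : ∀ n, g n = f n) : LogExp g c := by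
  rwa [show g = f from funext h]

theorem of_small {f : ℕ → ℂ} (c : ℂ) (hf : Small (fun n => f n - c)) : LogExp f c :=
  ⟨Polynomial.C c, by simp, by simpa using hf⟩

theorem const (c : ℂ) : LogExp (fun _ => c) c := of_small c (by simpa using Small.zero)

theorem add {f g : ℕ → ℂ} {c d : ℂ} (hf : LogExp f c) (hg : LogExp g d) :
    LogExp (fun n => f n + g n) (c + d) := by
  obtain ⟨P, hP, h⟩ := hf
  obtain ⟨Q, hQ, h'⟩ := hg
  exact ⟨P + Q, by simp [hP, hQ], (h.add h').congr fun n => by simp; ring⟩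

theorem mul {f g : ℕ → ℂ} {c d : ℂ} (hf : LogExp f c) (hg : LogExp g d) :
    LogExp (fun n => f n * g n) (c * d) := by
  obtain ⟨P, hP, h⟩ := hf
  obtain ⟨Q, hQ, h'⟩ := hg
  refine ⟨P * Q, by simp [Polynomial.mul_coeff_zero, hP, hQ],
    -- With `f = P + e` and `g = Q + e'`, the error of the product is `e e' + e Q + e' P`.
    (((h.mul h').add (h.mul_poly Q)).add (h'.mul_poly P)).congr fun n => ?_⟩
  simp only [Polynomial.eval_mul]
  ring

theorem const_mul {f : ℕ → ℂ} {c : ℂ} (hf : LogExp f c) (x : ℂ) :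
    LogExp (fun n => x * f n) (x * c) := (const x).mul hf

theorem finset_sum {ι : Type*} (s : Finset ι) {f : ι → ℕ → ℂ} {c : ι → ℂ}
    (h : ∀ i ∈ s, LogExp (f i) (c i)) : LogExp (fun n => ∑ i ∈ s, f i n) (∑ i ∈ s, c i) := by
  classical
  induction s using Finset.induction_on with
  | empty => simpa using const 0
  | insert i s hi ih =>
    rw [Finset.sum_insert hi]
    refine ((h i (by simp)).add (ih fun j hj => h j (by simp [hj]))).congr fun n => ?_
    rw [Finset.sum_insert hi]

theorem pow {f : ℕ → ℂ} {c : ℂ} (hf : LogExp f c) (k : ℕ) : LogExp (fun n => f n ^ k) (c ^ k) := by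
  induction k with
  | zero => simpa using const 1
  | succ k ih => simpa only [pow_succ] using ih.mul hf

theorem div_succ {f : ℕ → ℂ} {c : ℂ} (hf : LogExp f c) :
    LogExp (fun n => f n / ((n : ℂ) + 1)) 0 := by
  simpa [div_eq_mul_inv] using hf.mul (of_small 0 (by simpa using Small.inv_succ))

theorem sum_div_succ {f : ℕ → ℂ} {c : ℂ} (hf : LogExp f c) :
    ∃ d, LogExp (fun N => ∑ m ∈ Finset.range N, f m / ((m : ℂ) + 1)) d := by
  obtain ⟨P, -, h⟩ := hf
  obtain ⟨c, hc⟩ := h.sum_div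
  have hk : ∀ k : ℕ, ∃ d, LogExp (fun N => ∑ m ∈ Finset.range N, logSeq m ^ k / ((m : ℂ) + 1)) d := by
    intro k
    obtain ⟨d, hd⟩ := sum_logSeq_pow_div k
    refine ⟨_, Polynomial.X ^ (k + 1) * Polynomial.C (1 / ((k : ℂ) + 1)) - Polynomial.C d, rfl,
      hd.congr fun N => ?_⟩
    simp only [Polynomial.eval_sub, Polynomial.eval_mul, Polynomial.eval_pow, Polynomial.eval_X,
      Polynomial.eval_C, mul_one_div]
  choose d hd using hk
  refine ⟨_, ((of_small c hc).add (finset_sum P.support fun k _ =>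
    (hd k).const_mul (P.coeff k))).congr fun N => ?_⟩
  simp only [Finset.mul_sum]
  rw [Finset.sum_comm, ← Finset.sum_add_distrib]
  refine Finset.sum_congr rfl fun m _ => ?_
  rw [Polynomial.eval_eq_sum, Polynomial.sum, sub_div, Finset.sum_div, sub_add_eq_add_sub,
    add_sub_assoc, ← Finset.sum_sub_distrib, Finset.sum_eq_zero, add_zero]
  intro k _
  ring

/-- Induction on the word: division by `m + 1` and summation against `1/(m + 1)` both preserve
expansions in `log`. -/
theorem harmonicSum (w : Word) : ∃ c, LogExp (EulerianStars.harmonicSum w) c := by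
  induction w with
  | nil => exact ⟨1, const 1⟩
  | cons s w ih =>
    obtain ⟨c, hc⟩ := ih
    have hpow : ∀ k : ℕ, ∃ d,
        LogExp (fun m => EulerianStars.harmonicSum w m / ((m : ℂ) + 1) ^ k) d := by
      intro k
      induction k with
      | zero => exact ⟨c, by simpa using hc⟩
      | succ k ih =>
        obtain ⟨d, hd⟩ := ih
        exact ⟨0, hd.div_succ.congr fun n => by rw [pow_succ, div_div]⟩
    -- One of the `s` factors `1/(m + 1)` is kept for the summation.
    obtain ⟨d, hd⟩ := hpow (s.natPred)
    obtain ⟨d', hd'⟩ := hd.sum_div_succ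
    refine ⟨d', hd'.congr fun N => ?_⟩
    rw [EulerianStars.harmonicSum]
    refine Finset.sum_congr rfl fun m _ => ?_
    rw [div_div, ← pow_succ, s.natPred_add_one]

/-- A bounded polynomial in `log n` is constant. -/
theorem tendsto_of_bounded {f : ℕ → ℂ} {B : ℝ} {d : ℂ} (hf : LogExp f d) (hB : ∀ n, ‖f n‖ ≤ B) :
    Tendsto f atTop (𝓝 d) := by
  obtain ⟨P, rfl, h⟩ := hf
  have ht := h.tendsto
  have hlog : Tendsto (fun n : ℕ => Real.log (n : ℝ)) atTop atTop :=
    Real.tendsto_log_atTop.comp tendsto_natCast_atTop_atTop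
  have hdeg : P.degree ≤ 0 := by
    by_contra hP
    push Not at hP
    have h1 : Tendsto (fun n : ℕ => ‖P.eval (logSeq n)‖) atTop atTop := by
      apply Polynomial.tendsto_norm_atTop P hP
      refine tendsto_atTop_mono (fun n => ?_) hlog
      rw [logSeq, Complex.norm_real]
      exact le_abs_self _
    -- A nonconstant polynomial would exceed `B + 1` where the error is below `1`, contradicting the
    -- bound `B`.
    obtain ⟨n, hn1, hn2⟩ := ((h1.eventually_gt_atTop (B + 1)).and
      (ht.norm.eventually_lt_const (by simp : ‖(0 : ℂ)‖ < 1))).exists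
    have := norm_sub_norm_le (P.eval (logSeq n)) (f n)
    rw [norm_sub_rev] at this
    linarith [hB n]
  rw [Polynomial.eq_C_of_degree_le_zero hdeg] at ht ⊢
  simpa using ht.add_const (P.coeff 0)

theorem hasFinitePart {f : ℕ → ℂ} {c : ℂ} (hf : LogExp f c) : HasFinitePart f c := by
  obtain ⟨P, rfl, h⟩ := hf
  refine ⟨∑ k ∈ P.support, Finsupp.single (0, k) (P.coeff k), ?_, ?_⟩
  · rw [Finsupp.finsetSum_apply, Finset.sum_eq_single 0]
    · simp
    · intro k _ hk
      simp [hk]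
    · intro h0
      simpa using h0
  · refine h.tendsto.congr fun n => ?_
    rw [← Finsupp.sum_finsetSum_index (by simp) (by intros; ring)]
    rw [Polynomial.eval_eq_sum, Polynomial.sum]
    congr 1
    refine Finset.sum_congr rfl fun k _ => ?_
    rw [Finsupp.sum_single_index (by simp)]
    simp [logSeq]

end LogExp

/-! ### Uniqueness of finite parts -/

/-- The functions of the scale `n^a (log n)^b`. -/
def scale (p : ℤ × ℕ) (n : ℕ) : ℂ := (n : ℂ) ^ p.1 * logSeq n ^ p.2

/-- The scale is ordered lexicographically: the power of `n` decides, then the power of the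
logarithm. -/
theorem tendsto_scale_ratio {p q : ℤ × ℕ} (h : p.1 < q.1 ∨ p.1 = q.1 ∧ p.2 < q.2) :
    Tendsto (fun n => scale p n / scale q n) atTop (𝓝 0) := by
  have hlog : Tendsto (fun n : ℕ => Real.log (n : ℝ)) atTop atTop :=
    Real.tendsto_log_atTop.comp tendsto_natCast_atTop_atTop
  have hnorm : ∀ n : ℕ, ‖scale p n / scale q n‖ =
      ((n : ℝ) ^ p.1 * Real.log n ^ p.2) / ((n : ℝ) ^ q.1 * Real.log n ^ q.2) := by
    intro n
    simp [scale, norm_logSeq]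
  rcases h with h | ⟨h1, h2⟩
  · have h0 : Tendsto (fun n : ℕ => Real.log (n : ℝ) ^ p.2 / (n : ℝ)) atTop (𝓝 0) :=
      (Real.isLittleO_pow_log_id_atTop (n := p.2)).tendsto_div_nhds_zero.comp
        tendsto_natCast_atTop_atTop
    refine squeeze_zero_norm' ?_ h0
    filter_upwards [hlog.eventually_ge_atTop 1, eventually_ge_atTop 1] with n hn hn1
    have hn1' : (1 : ℝ) ≤ n := by exact_mod_cast hn1
    have hnp : (0 : ℝ) < n := by linarith
    rw [hnorm n, div_le_div_iff₀ (by positivity) hnp]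
    have e1 : (n : ℝ) ^ p.1 * n ≤ (n : ℝ) ^ q.1 := by
      rw [← zpow_add_one₀ hnp.ne']
      exact zpow_le_zpow_right₀ hn1' (by omega)
    have e2 : (1 : ℝ) ≤ Real.log n ^ q.2 := one_le_pow₀ hn
    calc (n : ℝ) ^ p.1 * Real.log n ^ p.2 * n
        = Real.log n ^ p.2 * (((n : ℝ) ^ p.1 * n) * 1) := by ring
      _ ≤ Real.log n ^ p.2 * ((n : ℝ) ^ q.1 * Real.log n ^ q.2) := by gcongr
  · have h0 : Tendsto (fun n : ℕ => (Real.log (n : ℝ))⁻¹) atTop (𝓝 0) :=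
      tendsto_inv_atTop_zero.comp hlog
    refine squeeze_zero_norm' ?_ h0
    filter_upwards [hlog.eventually_ge_atTop 1, eventually_ge_atTop 1] with n hn hn1
    have hnp : (0 : ℝ) < n := by exact_mod_cast hn1
    have hl : 0 < Real.log (n : ℝ) := by linarith
    rw [hnorm n, h1, mul_div_mul_left _ _ (zpow_pos hnp _).ne', inv_eq_one_div,
      div_le_div_iff₀ (by positivity) hl, one_mul, ← pow_succ]
    exact pow_le_pow_right₀ hn h2

/-- Division by the dominant function leaves its coefficient as limit. Adding `(0, 0)` to the
support makes that function at least `1` eventually, so the quotient still tends to zero; a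
vanishing coefficient forces the dominant index to be `(0, 0)`. -/
theorem eq_zero_of_tendsto_scale {C : (ℤ × ℕ) →₀ ℂ}
    (h : Tendsto (fun n => C.sum fun p k => k * scale p n) atTop (𝓝 0)) : C (0, 0) = 0 := by
  classical
  obtain ⟨M, hM, hmax⟩ := Finset.exists_max_image (insert (0, 0) C.support)
    (fun p : ℤ × ℕ => toLex p) ⟨(0, 0), by simp⟩
  have hM0 : (0 : ℤ) ≤ M.1 := by
    have := hmax (0, 0) (by simp)
    rw [Prod.Lex.le_iff] at this
    rcases this with h | h
    · exact le_of_lt h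
    · exact h.1.le
  have hev : ∀ᶠ n : ℕ in atTop, 1 ≤ ‖scale M n‖ := by
    have hlog : Tendsto (fun n : ℕ => Real.log (n : ℝ)) atTop atTop :=
      Real.tendsto_log_atTop.comp tendsto_natCast_atTop_atTop
    filter_upwards [hlog.eventually_ge_atTop 1, eventually_ge_atTop 1] with n hn hn1
    have hn1' : (1 : ℝ) ≤ n := by exact_mod_cast hn1
    have : ‖scale M n‖ = (n : ℝ) ^ M.1 * Real.log n ^ M.2 := by
      simp [scale, norm_logSeq]
    rw [this]
    exact one_le_mul_of_one_le_of_one_le (one_le_zpow₀ hn1' hM0) (one_le_pow₀ hn)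
  have h1 : Tendsto (fun n => (C.sum fun p k => k * scale p n) / scale M n) atTop (𝓝 0) := by
    refine squeeze_zero_norm' ?_ (by simpa using h.norm)
    filter_upwards [hev] with n hn
    rw [norm_div]
    exact div_le_self (norm_nonneg _) hn
  have h2 : Tendsto (fun n => (C.sum fun p k => k * scale p n) / scale M n) atTop (𝓝 (C M)) := by
    have : ∀ p ∈ C.support, Tendsto (fun n => C p * scale p n / scale M n) atTop
        (𝓝 (if p = M then C M else 0)) := by
      intro p hp
      split_ifs with hpM
      · subst hpM
        refine tendsto_const_nhds.congr' ?_
        filter_upwards [hev] with n hn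
        have : scale p n ≠ 0 := by rw [← norm_pos_iff]; linarith
        rw [mul_div_assoc, div_self this, mul_one]
      · have hle := hmax p (by simp [Finsupp.mem_support_iff.1 hp])
        rw [Prod.Lex.le_iff] at hle
        have hlt : p.1 < M.1 ∨ p.1 = M.1 ∧ p.2 < M.2 := by
          rcases hle with h | ⟨h1, h2⟩
          · exact Or.inl h
          · refine Or.inr ⟨h1, lt_of_le_of_ne h2 fun h3 => hpM (Prod.ext h1 h3)⟩
        simpa [mul_div_assoc] using (tendsto_scale_ratio hlt).const_mul (C p)
    have hs := tendsto_finsetSum C.support this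
    have e : ∑ p ∈ C.support, (if p = M then C M else 0) = C M := by
      rw [Finset.sum_ite_eq']
      split_ifs with hm
      · rfl
      · simpa using (Finsupp.notMem_support_iff.1 hm).symm
    rw [e] at hs
    refine hs.congr fun n => ?_
    rw [Finsupp.sum, Finset.sum_div]
  have hCM : C M = 0 := tendsto_nhds_unique h2 h1
  rcases Finset.mem_insert.1 hM with h | h
  · rw [← h]; exact hCM
  · exact absurd hCM (Finsupp.mem_support_iff.1 h)

theorem HasFinitePart.unique {f : ℕ → ℂ} {c d : ℂ} (hc : HasFinitePart f c)
    (hd : HasFinitePart f d) : c = d := by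
  obtain ⟨C, rfl, hC⟩ := hc
  obtain ⟨D, rfl, hD⟩ := hd
  have h := hD.sub hC
  rw [sub_zero] at h
  have : (C - D) (0, 0) = 0 := by
    refine eq_zero_of_tendsto_scale (h.congr fun n => ?_)
    rw [Finsupp.sum_sub_index (by intros; ring)]
    simp only [scale, logSeq]
    ring
  rw [Finsupp.sub_apply] at this
  exact sub_eq_zero.1 this

theorem LogExp.unique {f : ℕ → ℂ} {c d : ℂ} (hc : LogExp f c) (hd : LogExp f d) : c = d :=
  hc.hasFinitePart.unique hd.hasFinitePart

theorem hasFinitePart_gammaWord (w : Word) : HasFinitePart (harmonicSum w) (gammaWord w) := by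
  obtain ⟨c, hc⟩ := LogExp.harmonicSum w
  exact Classical.epsilon_spec ⟨c, hc.hasFinitePart⟩

/-- By uniqueness, the finite part chosen in the full scale is the constant term of the polynomial
in `log n`. -/
theorem logExp_gammaWord (w : Word) : LogExp (harmonicSum w) (gammaWord w) := by
  obtain ⟨c, hc⟩ := LogExp.harmonicSum w
  rwa [(hasFinitePart_gammaWord w).unique hc.hasFinitePart]

theorem gammaWord_one : gammaWord [1] = (Real.eulerMascheroniConstant : ℂ) := by
  refine (hasFinitePart_gammaWord [1]).unique
    ⟨Finsupp.single (0, 0) (Real.eulerMascheroniConstant : ℂ) + Finsupp.single (0, 1) 1, ?_, ?_⟩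
  · simp
  · have h := Real.tendsto_harmonic_sub_log
    have h' : Tendsto (fun n : ℕ => (((harmonic n : ℝ) - Real.log n - Real.eulerMascheroniConstant : ℝ) : ℂ))
        atTop (𝓝 0) := by
      have := (Complex.continuous_ofReal.tendsto _).comp (h.sub_const Real.eulerMascheroniConstant)
      rwa [sub_self, Complex.ofReal_zero] at this
    refine h'.congr fun n => ?_
    rw [Finsupp.sum_add_index' (by simp) (by intros; ring), Finsupp.sum_single_index (by simp),
      Finsupp.sum_single_index (by simp)]
    simp [harmonicSum, harmonic]
    ring

/-! ### Generating series by weight -/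

/-- The power series `1 + ∑_{s ≥ 1} a_s X^s`. -/
def letterSeries (a : ℕ+ → ℂ) : PowerSeries ℂ :=
  PowerSeries.mk fun n => if n = 0 then 1 else a n.toPNat'

/-- The generating series by weight of the truncated values of the star of `∑ a_s y_s`. -/
def harmonicSeries (a : ℕ+ → ℂ) (N : ℕ) : PowerSeries ℂ :=
  ∏ m ∈ Finset.range N, PowerSeries.rescale ((m : ℂ) + 1)⁻¹ (letterSeries a)

/-- The generating series by weight of the values of `γ` on the star of `∑ a_s y_s`. -/
def gammaGen (a : ℕ+ → ℂ) : PowerSeries ℂ :=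
  PowerSeries.mk (gammaComponent (kleeneStar (letters a)))

theorem coeff_letterSeries_zero (a : ℕ+ → ℂ) : PowerSeries.coeff 0 (letterSeries a) = 1 := by
  simp [letterSeries]

theorem coeff_letterSeries_of_ne_zero (a : ℕ+ → ℂ) {n : ℕ} (hn : n ≠ 0) :
    PowerSeries.coeff n (letterSeries a) = a n.toPNat' := by
  simp [letterSeries, hn]

theorem coeff_letterSeries_pnat (a : ℕ+ → ℂ) (s : ℕ+) :
    PowerSeries.coeff (s : ℕ) (letterSeries a) = a s := by
  rw [coeff_letterSeries_of_ne_zero a s.ne_zero, PNat.coe_toPNat']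

/-- A sum over the words of weight `n`, decomposed by the first letter. -/
theorem sum_wordsOfWeight_cons (n : ℕ) (G : Word → ℂ) (h0 : G [] = 0) :
    ∑ w ∈ wordsOfWeight n, G w = ∑ p ∈ Finset.HasAntidiagonal.antidiagonal n,
      if p.1 = 0 then 0 else ∑ w ∈ wordsOfWeight p.2, G (p.1.toPNat' :: w) := by
  simp only [← ite_not (_ = _) _ (0 : ℂ)]
  rw [← Finset.sum_filter, Finset.sum_sigma']
  symm
  rw [← Finset.sum_filter_of_ne (s := wordsOfWeight n) (p := fun w => w ≠ [])
    (fun w _ h hw => h (by rw [hw, h0]))]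
  refine Finset.sum_bij (fun x _ => x.1.1.toPNat' :: x.2) ?_ ?_ ?_ (fun _ _ => rfl)
  · rintro ⟨⟨i, j⟩, w⟩ hx
    simp only [Finset.mem_sigma, Finset.mem_filter, Finset.HasAntidiagonal.mem_antidiagonal,
      mem_wordsOfWeight] at hx
    obtain ⟨⟨h1, h2⟩, h3⟩ := hx
    simp [Nat.toPNat'_coe, Nat.pos_of_ne_zero h2, h3, h1]
  · rintro ⟨⟨i, j⟩, w⟩ hx ⟨⟨i', j'⟩, w'⟩ hx' heq
    simp only [Finset.mem_sigma, Finset.mem_filter, Finset.HasAntidiagonal.mem_antidiagonal,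
      mem_wordsOfWeight] at hx hx'
    simp only [List.cons.injEq] at heq
    obtain ⟨h1, rfl⟩ := heq
    have h2 := congrArg PNat.val h1
    simp only [Nat.toPNat'_coe, Nat.pos_of_ne_zero hx.1.2, Nat.pos_of_ne_zero hx'.1.2,
      if_true] at h2
    have h3 : j = j' := by omega
    subst h2 h3
    rfl
  · intro w hw
    simp only [Finset.mem_filter, mem_wordsOfWeight] at hw
    cases w with
    | nil => exact absurd rfl hw.2
    | cons s w =>
      refine ⟨⟨((s : ℕ), weight w), w⟩, ?_, ?_⟩
      · simpa using hw.1
      · simp [PNat.coe_toPNat']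

theorem harmonicSum_succ_cons (s : ℕ+) (w : Word) (N : ℕ) :
    harmonicSum (s :: w) (N + 1) =
      harmonicSum (s :: w) N + harmonicSum w N / ((N : ℂ) + 1) ^ (s : ℕ) := by
  rw [harmonicSum, Finset.sum_range_succ]
  rfl

/-- The first letter carries the largest summation index, so passing from `N` to `N + 1` adds the
words whose first letter sits at `N + 1`; this is multiplication by one more factor. -/
theorem coeff_harmonicSeries (a : ℕ+ → ℂ) (n N : ℕ) :
    PowerSeries.coeff n (harmonicSeries a N) =
      ∑ w ∈ wordsOfWeight n, kleeneStar (letters a) w * harmonicSum w N := by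
  induction N generalizing n with
  | zero =>
    have h : ∀ w : Word, harmonicSum w 0 = if w = [] then 1 else 0 := by
      intro w; cases w <;> simp [harmonicSum]
    simp only [h, mul_ite, mul_one, mul_zero, harmonicSeries, Finset.range_zero,
      Finset.prod_empty, PowerSeries.coeff_one]
    rw [Finset.sum_ite_eq']
    simp [kleeneStar_letters_nil, eq_comm]
  | succ N ih =>
    have hstep : ∑ w ∈ wordsOfWeight n, kleeneStar (letters a) w * harmonicSum w (N + 1) =
        ∑ w ∈ wordsOfWeight n, kleeneStar (letters a) w * harmonicSum w N +
        ∑ w ∈ wordsOfWeight n,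
          kleeneStar (letters a) w * (harmonicSum w (N + 1) - harmonicSum w N) := by
      rw [← Finset.sum_add_distrib]
      exact Finset.sum_congr rfl fun w _ => by ring
    rw [hstep, sum_wordsOfWeight_cons n
      (fun w => kleeneStar (letters a) w * (harmonicSum w (N + 1) - harmonicSum w N))
      (by simp [harmonicSum]), harmonicSeries, Finset.prod_range_succ, mul_comm, ← harmonicSeries,
      PowerSeries.coeff_mul, ← ih]
    have hfirst : PowerSeries.coeff n (harmonicSeries a N) = ∑ p ∈ Finset.HasAntidiagonal.antidiagonal n,
        if p.1 = 0 then PowerSeries.coeff p.2 (harmonicSeries a N) else 0 := by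
      rw [Finset.sum_eq_single (0, n)]
      · simp
      · rintro ⟨i, j⟩ h1 h2
        simp only [Finset.HasAntidiagonal.mem_antidiagonal] at h1
        rw [if_neg]
        rintro rfl
        exact h2 (by simpa using h1)
      · simp
    rw [hfirst, ← Finset.sum_add_distrib]
    refine Finset.sum_congr rfl fun p _ => ?_
    rw [PowerSeries.coeff_rescale]
    split_ifs with h
    · simp [h, coeff_letterSeries_zero]
    · rw [coeff_letterSeries_of_ne_zero a h, ih, zero_add, Finset.mul_sum]
      refine Finset.sum_congr rfl fun w _ => ?_
      rw [harmonicSum_succ_cons, kleeneStar_letters_cons, Nat.toPNat'_coe,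
        if_pos (Nat.pos_of_ne_zero h), inv_pow]
      ring

/-! ### Coefficientwise expansions -/

/-- The coefficients of `H N` have expansions in powers of `log N`, with constant terms `c`. -/
def LogExpSeries (H : ℕ → PowerSeries ℂ) (c : PowerSeries ℂ) : Prop :=
  ∀ n, LogExp (fun N => PowerSeries.coeff n (H N)) (PowerSeries.coeff n c)

theorem LogExpSeries.mul {H K : ℕ → PowerSeries ℂ} {c d : PowerSeries ℂ} (hH : LogExpSeries H c)
    (hK : LogExpSeries K d) : LogExpSeries (fun N => H N * K N) (c * d) := by
  intro n
  simp only [PowerSeries.coeff_mul]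
  exact LogExp.finset_sum _ fun p _ => (hH p.1).mul (hK p.2)

theorem LogExpSeries.unique {H : ℕ → PowerSeries ℂ} {c d : PowerSeries ℂ}
    (hc : LogExpSeries H c) (hd : LogExpSeries H d) : c = d :=
  PowerSeries.ext fun n => (hc n).unique (hd n)

theorem logExpSeries_harmonicSeries (a : ℕ+ → ℂ) :
    LogExpSeries (harmonicSeries a) (gammaGen a) := by
  intro n
  rw [gammaGen, PowerSeries.coeff_mk]
  refine (LogExp.finset_sum (wordsOfWeight n) fun w _ =>
    (logExp_gammaWord w).const_mul (kleeneStar (letters a) w)).congr fun N => ?_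
  rw [coeff_harmonicSeries]

/-- The two ends of the antidiagonal give `a_n + b_n`, its interior the merged letters. -/
theorem letterSeries_starLaw (a b : ℕ+ → ℂ) :
    letterSeries (starLaw a b) = letterSeries a * letterSeries b := by
  ext n
  rw [PowerSeries.coeff_mul]
  rcases Nat.eq_zero_or_pos n with rfl | hn
  · simp [coeff_letterSeries_zero]
  · obtain ⟨s, rfl⟩ : ∃ s : ℕ+, n = s := ⟨⟨n, hn⟩, rfl⟩
    have hs := s.ne_zero
    have himage : Finset.HasAntidiagonal.antidiagonal (s : ℕ) = insert (0, (s : ℕ)) (insert ((s : ℕ), 0)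
        (((Finset.Iio s ×ˢ Finset.Iio s).filter (fun p => p.1 + p.2 = s)).image
          (fun p : ℕ+ × ℕ+ => ((p.1 : ℕ), (p.2 : ℕ))))) := by
      ext ⟨i, j⟩
      simp only [Finset.HasAntidiagonal.mem_antidiagonal, Finset.mem_insert, Finset.mem_image, Finset.mem_filter,
        Finset.mem_product, Finset.mem_Iio, Prod.mk.injEq, Prod.exists]
      constructor
      · intro h
        rcases Nat.eq_zero_or_pos i with hi | hi
        · left; omega
        rcases Nat.eq_zero_or_pos j with hj | hj
        · right; left; omega
        right; right
        obtain ⟨p, rfl⟩ : ∃ p : ℕ+, i = p := ⟨⟨i, hi⟩, rfl⟩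
        obtain ⟨q, rfl⟩ : ∃ q : ℕ+, j = q := ⟨⟨j, hj⟩, rfl⟩
        have hpq : p + q = s := PNat.coe_injective (by simpa using h)
        exact ⟨p, q, ⟨⟨hpq ▸ PNat.lt_add_right p q, hpq ▸ PNat.lt_add_left q p⟩, hpq⟩, rfl, rfl⟩
      · rintro (⟨rfl, rfl⟩ | ⟨rfl, rfl⟩ | ⟨p, q, ⟨-, h⟩, rfl, rfl⟩)
        · simp
        · simp
        · rw [← h]; simp
    rw [himage, Finset.sum_insert, Finset.sum_insert, Finset.sum_image]
    · simp only [coeff_letterSeries_zero, coeff_letterSeries_pnat, starLaw]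
      ring
    · rintro ⟨p, q⟩ _ ⟨p', q'⟩ _ h
      simpa using h
    · simp
    · simp [hs, hs.symm]

theorem harmonicSeries_starLaw (a b : ℕ+ → ℂ) (N : ℕ) :
    harmonicSeries (starLaw a b) N = harmonicSeries a N * harmonicSeries b N := by
  simp only [harmonicSeries, letterSeries_starLaw, map_mul, Finset.prod_mul_distrib]

/-- The truncated generating series multiply exactly for each `N`, and constant terms of expansions
in `log N` multiply with them. -/
theorem gammaGen_starLaw (a b : ℕ+ → ℂ) :
    gammaGen (starLaw a b) = gammaGen a * gammaGen b := by
  refine (logExpSeries_harmonicSeries _).unique ?_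
  have := (logExpSeries_harmonicSeries a).mul (logExpSeries_harmonicSeries b)
  simpa only [← harmonicSeries_starLaw] using this

/-- `γ` is multiplicative on the stars of its domain (Abel's theorem). -/
theorem gammaSeries_starLaw {a b : ℕ+ → ℂ} (ha : kleeneStar (letters a) ∈ gammaDom)
    (hb : kleeneStar (letters b) ∈ gammaDom) (hab : kleeneStar (letters (starLaw a b)) ∈ gammaDom) :
    gammaSeries (kleeneStar (letters (starLaw a b))) =
      gammaSeries (kleeneStar (letters a)) * gammaSeries (kleeneStar (letters b)) := by
  obtain ⟨A, hA⟩ := ha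
  obtain ⟨B, hB⟩ := hb
  obtain ⟨D, hD⟩ := hab
  rw [gammaSeries, gammaSeries, gammaSeries, hA.limUnder_eq, hB.limUnder_eq, hD.limUnder_eq]
  have hcoef : ∀ n, gammaComponent (kleeneStar (letters (starLaw a b))) n =
      ∑ p ∈ Finset.HasAntidiagonal.antidiagonal n, gammaComponent (kleeneStar (letters a)) p.1 *
        gammaComponent (kleeneStar (letters b)) p.2 := by
    intro n
    have := congrArg (PowerSeries.coeff n) (gammaGen_starLaw a b)
    simpa only [PowerSeries.coeff_mul, gammaGen, PowerSeries.coeff_mk] using this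
  -- The terms of a convergent series are bounded, so its power series converges absolutely inside
  -- the unit disc and Cauchy products are allowed there.
  have hsummable : ∀ {f : ℕ → ℂ} {l : ℂ},
      Tendsto (fun N => ∑ n ∈ Finset.range N, f n) atTop (𝓝 l) → ∀ x : ℝ, 0 < x → x < 1 →
      Summable (fun n => ‖f n * (x : ℂ) ^ n‖) := by
    intro f l hf x hx0 hx1
    have h0 : Tendsto f atTop (𝓝 0) := by
      have := (hf.comp (tendsto_add_atTop_nat 1)).sub hf
      rw [sub_self] at this
      refine this.congr fun n => ?_
      simp [Finset.sum_range_succ]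
    obtain ⟨C, hC⟩ := h0.norm.bddAbove_range
    refine Summable.of_nonneg_of_le (fun _ => norm_nonneg _) (fun n => ?_)
      ((summable_geometric_of_lt_one hx0.le hx1).mul_left C)
    rw [norm_mul, norm_pow, Complex.norm_real, Real.norm_of_nonneg hx0.le]
    exact mul_le_mul_of_nonneg_right (hC ⟨n, rfl⟩) (by positivity)
  have tA := Complex.tendsto_tsum_powerSeries_nhdsWithin_lt hA
  have tB := Complex.tendsto_tsum_powerSeries_nhdsWithin_lt hB
  have tD := Complex.tendsto_tsum_powerSeries_nhdsWithin_lt hD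
  rw [tendsto_map'_iff] at tA tB tD
  refine tendsto_nhds_unique tD ((tA.mul tB).congr' ?_)
  filter_upwards [Ioo_mem_nhdsLT (zero_lt_one (α := ℝ))] with x hx
  simp only [Function.comp_apply]
  rw [tsum_mul_tsum_eq_tsum_sum_antidiagonal_of_summable_norm (hsummable hA x hx.1 hx.2)
    (hsummable hB x hx.1 hx.2)]
  refine tsum_congr fun n => ?_
  rw [hcoef, Finset.sum_mul]
  refine Finset.sum_congr rfl fun p hp => ?_
  rw [← Finset.HasAntidiagonal.mem_antidiagonal.1 hp, pow_add]
  ring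

/-! ### Absolutely summable power series -/

/-- The series of the coefficients converges absolutely. -/
def AbsSummable (F : PowerSeries ℂ) : Prop := Summable fun n => ‖PowerSeries.coeff n F‖

/-- The sum of the absolute values of the coefficients. -/
def absNorm (F : PowerSeries ℂ) : ℝ := ∑' n, ‖PowerSeries.coeff n F‖

/-- The sum of the coefficients. -/
def coeffSum (F : PowerSeries ℂ) : ℂ := ∑' n, PowerSeries.coeff n F

theorem norm_coeff_mul_le (F G : PowerSeries ℂ) (n : ℕ) :
    ‖PowerSeries.coeff n (F * G)‖ ≤ ∑ p ∈ Finset.HasAntidiagonal.antidiagonal n,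
      ‖PowerSeries.coeff p.1 F‖ * ‖PowerSeries.coeff p.2 G‖ := by
  rw [PowerSeries.coeff_mul]
  exact (norm_sum_le _ _).trans (le_of_eq (Finset.sum_congr rfl fun _ _ => norm_mul _ _))

namespace AbsSummable

theorem summable_antidiagonal {F G : PowerSeries ℂ} (hF : AbsSummable F) (hG : AbsSummable G) :
    Summable (fun n => ∑ p ∈ Finset.HasAntidiagonal.antidiagonal n,
      ‖PowerSeries.coeff p.1 F‖ * ‖PowerSeries.coeff p.2 G‖) := by
  have hF' : Summable (fun n => ‖‖PowerSeries.coeff n F‖‖) := by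
    simp only [norm_norm]; exact hF
  have hG' : Summable (fun n => ‖‖PowerSeries.coeff n G‖‖) := by
    simp only [norm_norm]; exact hG
  exact (summable_norm_sum_mul_antidiagonal_of_summable_norm hF' hG').of_norm

theorem mul {F G : PowerSeries ℂ} (hF : AbsSummable F) (hG : AbsSummable G) :
    AbsSummable (F * G) :=
  Summable.of_nonneg_of_le (fun _ => norm_nonneg _) (norm_coeff_mul_le F G)
    (hF.summable_antidiagonal hG)

theorem absNorm_mul_le {F G : PowerSeries ℂ} (hF : AbsSummable F) (hG : AbsSummable G) :
    absNorm (F * G) ≤ absNorm F * absNorm G := by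
  refine (Summable.tsum_le_tsum (norm_coeff_mul_le F G) (hF.mul hG)
    (hF.summable_antidiagonal hG)).trans (le_of_eq ?_)
  have h := Summable.mul_of_nonneg (f := fun n => ‖PowerSeries.coeff n F‖)
    (g := fun n => ‖PowerSeries.coeff n G‖) hF hG (fun _ => norm_nonneg _) (fun _ => norm_nonneg _)
  exact (Summable.tsum_mul_tsum_eq_tsum_sum_antidiagonal
    (f := fun n => ‖PowerSeries.coeff n F‖) (g := fun n => ‖PowerSeries.coeff n G‖) hF hG h).symm

theorem coeffSum_mul {F G : PowerSeries ℂ} (hF : AbsSummable F) (hG : AbsSummable G) :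
    coeffSum (F * G) = coeffSum F * coeffSum G := by
  rw [coeffSum, coeffSum, coeffSum, tsum_mul_tsum_eq_tsum_sum_antidiagonal_of_summable_norm hF hG]
  exact tsum_congr fun n => PowerSeries.coeff_mul n F G

theorem one : AbsSummable 1 :=
  summable_of_ne_finset_zero (s := {0}) fun n hn => by
    simp only [Finset.mem_singleton] at hn
    simp [PowerSeries.coeff_one, hn]

theorem prod {ι : Type*} (s : Finset ι) {F : ι → PowerSeries ℂ} (h : ∀ i ∈ s, AbsSummable (F i)) :
    AbsSummable (∏ i ∈ s, F i) := Finset.prod_induction F AbsSummable (fun _ _ => mul) one h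

theorem rescale {F : PowerSeries ℂ} (hF : AbsSummable F) {x : ℂ} (hx : ‖x‖ ≤ 1) :
    AbsSummable (PowerSeries.rescale x F) := by
  refine Summable.of_nonneg_of_le (fun _ => norm_nonneg _) (fun n => ?_) hF
  rw [PowerSeries.coeff_rescale, norm_mul, norm_pow]
  exact mul_le_of_le_one_left (norm_nonneg _) (pow_le_one₀ (norm_nonneg _) hx)

end AbsSummable

theorem absNorm_nonneg (F : PowerSeries ℂ) : 0 ≤ absNorm F := tsum_nonneg fun _ => norm_nonneg _

theorem absNorm_one : absNorm 1 = 1 := by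
  rw [absNorm, tsum_eq_single 0]
  · simp
  · intro n hn
    simp [PowerSeries.coeff_one, hn]

theorem coeffSum_one : coeffSum 1 = 1 := by
  rw [coeffSum, tsum_eq_single 0]
  · simp
  · intro n hn
    simp [PowerSeries.coeff_one, hn]

theorem absNorm_prod_le {ι : Type*} (s : Finset ι) {F : ι → PowerSeries ℂ}
    (h : ∀ i ∈ s, AbsSummable (F i)) : absNorm (∏ i ∈ s, F i) ≤ ∏ i ∈ s, absNorm (F i) := by
  classical
  induction s using Finset.induction_on with
  | empty => simp [absNorm_one]
  | insert i s hi ih =>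
    rw [Finset.prod_insert hi, Finset.prod_insert hi]
    have hs : ∀ j ∈ s, AbsSummable (F j) := fun j hj => h j (by simp [hj])
    exact ((h i (by simp)).absNorm_mul_le (AbsSummable.prod s hs)).trans
      (mul_le_mul_of_nonneg_left (ih hs) (absNorm_nonneg _))

theorem coeffSum_prod {ι : Type*} (s : Finset ι) {F : ι → PowerSeries ℂ}
    (h : ∀ i ∈ s, AbsSummable (F i)) : coeffSum (∏ i ∈ s, F i) = ∏ i ∈ s, coeffSum (F i) := by
  classical
  induction s using Finset.induction_on with
  | empty => simp [coeffSum_one]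
  | insert i s hi ih =>
    rw [Finset.prod_insert hi, Finset.prod_insert hi]
    have hs : ∀ j ∈ s, AbsSummable (F j) := fun j hj => h j (by simp [hj])
    rw [(h i (by simp)).coeffSum_mul (AbsSummable.prod s hs), ih hs]

/-! ### Exponential series and estimates for rescaled factors -/

/-- The power series `exp (x X)`. -/
def expSeries (x : ℂ) : PowerSeries ℂ := PowerSeries.rescale x (PowerSeries.exp ℂ)

theorem coeff_expSeries (x : ℂ) (n : ℕ) :
    PowerSeries.coeff n (expSeries x) = x ^ n / (n.factorial : ℂ) := by
  simp [expSeries, PowerSeries.coeff_rescale, PowerSeries.coeff_exp, div_eq_mul_inv]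

theorem expSeries_mul (x y : ℂ) : expSeries x * expSeries y = expSeries (x + y) :=
  PowerSeries.exp_mul_exp_eq_exp_add x y

theorem rescale_expSeries (x y : ℂ) : PowerSeries.rescale x (expSeries y) = expSeries (x * y) := by
  ext n
  rw [PowerSeries.coeff_rescale, coeff_expSeries, coeff_expSeries, mul_pow]
  ring

theorem expSeries_zero : expSeries 0 = 1 := by
  ext n
  rw [coeff_expSeries, PowerSeries.coeff_one]
  split_ifs with h
  · simp [h]
  · simp [h]

theorem hasSum_norm_coeff_expSeries (x : ℂ) :
    HasSum (fun n => ‖PowerSeries.coeff n (expSeries x)‖) (Real.exp ‖x‖) := by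
  have h := NormedSpace.expSeries_div_hasSum_exp (‖x‖ : ℝ)
  rw [← Real.exp_eq_exp_ℝ] at h
  refine h.congr_fun fun n => ?_
  rw [coeff_expSeries, norm_div, norm_pow, Complex.norm_natCast]

theorem absSummable_expSeries (x : ℂ) : AbsSummable (expSeries x) :=
  (hasSum_norm_coeff_expSeries x).summable

theorem absNorm_expSeries (x : ℂ) : absNorm (expSeries x) = Real.exp ‖x‖ :=
  (hasSum_norm_coeff_expSeries x).tsum_eq

theorem coeffSum_expSeries (x : ℂ) : coeffSum (expSeries x) = Complex.exp x := by
  have h := NormedSpace.expSeries_div_hasSum_exp x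
  rw [← Complex.exp_eq_exp_ℂ] at h
  rw [coeffSum, ← h.tsum_eq]
  exact tsum_congr fun n => coeff_expSeries x n

/-- A series `1 + O(X²)` gets close to `1` when rescaled by a small number. -/
theorem absNorm_rescale_le {F : PowerSeries ℂ} (hF : AbsSummable F)
    (h0 : PowerSeries.coeff 0 F = 1) (h1 : PowerSeries.coeff 1 F = 0) {x : ℂ} (hx : ‖x‖ ≤ 1) :
    absNorm (PowerSeries.rescale x F) ≤ 1 + ‖x‖ ^ 2 * absNorm F := by
  have hs : Summable (fun n : ℕ => (if n = 0 then (1 : ℝ) else 0)) :=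
    summable_of_ne_finset_zero (s := {0}) (by simp)
  have h : ∀ n : ℕ, ‖PowerSeries.coeff n (PowerSeries.rescale x F)‖ ≤
      (if n = 0 then (1 : ℝ) else 0) + ‖x‖ ^ 2 * ‖PowerSeries.coeff n F‖ := by
    intro n
    rw [PowerSeries.coeff_rescale, norm_mul, norm_pow]
    match n with
    | 0 => simp [h0]
    | 1 => simp [h1]
    | n + 2 =>
      rw [if_neg (by omega), zero_add]
      exact mul_le_mul_of_nonneg_right (pow_le_pow_of_le_one (norm_nonneg _) hx (by omega))
        (norm_nonneg _)
  refine (Summable.tsum_le_tsum h (hF.rescale hx) (hs.add (hF.mul_left _))).trans (le_of_eq ?_)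
  rw [Summable.tsum_add hs (hF.mul_left _), tsum_mul_left, tsum_ite_eq]
  rfl

theorem hasSum_norm_coeff_letterSeries {a : ℕ+ → ℂ} (ha : Summable fun s => ‖a s‖) :
    HasSum (fun n => ‖PowerSeries.coeff n (letterSeries a)‖) (1 + ∑' s, ‖a s‖) := by
  rw [← hasSum_nat_add_iff' 1]
  simp only [Finset.range_one, Finset.sum_singleton, coeff_letterSeries_zero, norm_one,
    add_sub_cancel_left]
  rw [← hasSum_pnat_iff_hasSum_succ (f := fun n => ‖PowerSeries.coeff n (letterSeries a)‖)]
  simpa only [coeff_letterSeries_pnat] using ha.hasSum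

theorem norm_inv_succ (m : ℕ) : ‖((m : ℂ) + 1)⁻¹‖ = ((m : ℝ) + 1)⁻¹ := by
  rw [norm_inv]
  congr 1
  exact_mod_cast Complex.norm_natCast (m + 1)

theorem norm_inv_succ_le (m : ℕ) : ‖((m : ℂ) + 1)⁻¹‖ ≤ 1 := by
  rw [norm_inv_succ]
  exact inv_le_one_of_one_le₀ (by simp)

/-! ### Normalised products and absolute convergence -/

/-- The factor `(1 + ∑ a_s X^s) exp (-a_1 X) = 1 + O(X²)`. -/
def normalizedSeries (a : ℕ+ → ℂ) : PowerSeries ℂ := letterSeries a * expSeries (-a 1)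

/-- The partial products of the normalized factors. -/
def normalizedProd (a : ℕ+ → ℂ) (N : ℕ) : PowerSeries ℂ :=
  ∏ m ∈ Finset.range N, PowerSeries.rescale ((m : ℂ) + 1)⁻¹ (normalizedSeries a)

theorem harmonicSum_one (N : ℕ) : harmonicSum [1] N = ∑ m ∈ Finset.range N, ((m : ℂ) + 1)⁻¹ := by
  simp [harmonicSum]

/-- The normalising exponentials collect the harmonic number, which is where the logarithmic
divergence sits. -/
theorem normalizedProd_eq (a : ℕ+ → ℂ) (N : ℕ) :
    normalizedProd a N = harmonicSeries a N * expSeries (-a 1 * harmonicSum [1] N) := by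
  simp only [normalizedProd, normalizedSeries, map_mul, Finset.prod_mul_distrib, rescale_expSeries]
  rw [← harmonicSeries, harmonicSum_one]
  congr 1
  induction N with
  | zero => simp [expSeries_zero]
  | succ N ih =>
    rw [Finset.prod_range_succ, ih, Finset.sum_range_succ, expSeries_mul]
    congr 1
    ring

/-- The limit of the normalized partial products. -/
def normalizedLim (a : ℕ+ → ℂ) : PowerSeries ℂ :=
  gammaGen a * expSeries (-a 1 * Real.eulerMascheroniConstant)

theorem gammaGen_eq (a : ℕ+ → ℂ) :
    gammaGen a = normalizedLim a * expSeries (a 1 * Real.eulerMascheroniConstant) := by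
  rw [normalizedLim, mul_assoc, expSeries_mul, neg_mul, neg_add_cancel, expSeries_zero, mul_one]

theorem logExpSeries_normalizedProd (a : ℕ+ → ℂ) :
    LogExpSeries (normalizedProd a) (normalizedLim a) := by
  have h : LogExpSeries (fun N => expSeries (-a 1 * harmonicSum [1] N))
      (expSeries (-a 1 * Real.eulerMascheroniConstant)) := by
    intro n
    simp only [coeff_expSeries, div_eq_mul_inv]
    rw [← gammaWord_one]
    exact (((logExp_gammaWord [1]).const_mul (-a 1)).pow n).mul (LogExp.const _)
  have h' := (logExpSeries_harmonicSeries a).mul h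
  simp only [← normalizedProd_eq] at h'
  exact h'

section Bounds

variable {a : ℕ+ → ℂ} {M : ℝ}

theorem absSummable_normalizedSeries (ha : Summable fun s => ‖a s‖) :
    AbsSummable (normalizedSeries a) :=
  AbsSummable.mul (hasSum_norm_coeff_letterSeries ha).summable (absSummable_expSeries _)

theorem norm_le_tsum_norm (ha : Summable fun s => ‖a s‖) (s : ℕ+) : ‖a s‖ ≤ ∑' s, ‖a s‖ :=
  ha.le_tsum s fun _ _ => norm_nonneg _

theorem absNorm_normalizedSeries_le (ha : Summable fun s => ‖a s‖) (hM : ∑' s, ‖a s‖ ≤ M) :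
    absNorm (normalizedSeries a) ≤ (1 + M) * Real.exp M := by
  have h1 : AbsSummable (letterSeries a) := (hasSum_norm_coeff_letterSeries ha).summable
  have h2 : absNorm (letterSeries a) = 1 + ∑' s, ‖a s‖ :=
    (hasSum_norm_coeff_letterSeries ha).tsum_eq
  have h3 : 0 ≤ ∑' s, ‖a s‖ := tsum_nonneg fun _ => norm_nonneg _
  refine (h1.absNorm_mul_le (absSummable_expSeries _)).trans ?_
  rw [h2, absNorm_expSeries, norm_neg]
  have := (norm_le_tsum_norm ha 1).trans hM
  have hM0 : 0 ≤ M := h3.trans hM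
  gcongr

theorem coeff_zero_normalizedSeries (a : ℕ+ → ℂ) :
    PowerSeries.coeff 0 (normalizedSeries a) = 1 := by
  rw [normalizedSeries, PowerSeries.coeff_mul]
  simp [coeff_letterSeries_zero, coeff_expSeries]

theorem coeff_one_normalizedSeries (a : ℕ+ → ℂ) :
    PowerSeries.coeff 1 (normalizedSeries a) = 0 := by
  have h := coeff_letterSeries_pnat a 1
  rw [PNat.one_coe] at h
  rw [normalizedSeries, PowerSeries.coeff_mul]
  rw [Finset.Nat.antidiagonal_succ]
  simp [coeff_letterSeries_zero, coeff_expSeries, h]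

/-- A bound for the coefficients that depends only on `∑ ‖a_s‖`. -/
def normBound (M : ℝ) : ℝ :=
  Real.exp ((1 + M) * Real.exp M * ∑' m : ℕ, (((m : ℝ) + 1)⁻¹) ^ 2)

theorem summable_inv_succ_sq : Summable (fun m : ℕ => (((m : ℝ) + 1)⁻¹) ^ 2) := by
  have := (summable_nat_add_iff 1).2 (Real.summable_nat_pow_inv.2 (by norm_num : 1 < 2))
  exact this.congr fun m => by push_cast; rw [inv_pow]

theorem absSummable_normalizedProd (ha : Summable fun s => ‖a s‖) (N : ℕ) :
    AbsSummable (normalizedProd a N) :=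
  AbsSummable.prod _ fun m _ => (absSummable_normalizedSeries ha).rescale (norm_inv_succ_le m)

/-- Each factor has norm at most `1 + K/(m + 1)² ≤ exp(K/(m + 1)²)` with `K = (1 + M) e^M`, and the
exponents are summable. -/
theorem absNorm_normalizedProd_le (ha : Summable fun s => ‖a s‖) (hM : ∑' s, ‖a s‖ ≤ M) (N : ℕ) :
    absNorm (normalizedProd a N) ≤ normBound M := by
  have hM0 : 0 ≤ M := (tsum_nonneg fun _ => norm_nonneg _).trans hM
  have hs := absSummable_normalizedSeries ha
  refine (absNorm_prod_le _ fun m _ => hs.rescale (norm_inv_succ_le m)).trans ?_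
  have hstep : ∀ m ∈ Finset.range N,
      absNorm (PowerSeries.rescale ((m : ℂ) + 1)⁻¹ (normalizedSeries a)) ≤
        Real.exp ((1 + M) * Real.exp M * (((m : ℝ) + 1)⁻¹) ^ 2) := by
    intro m _
    refine (absNorm_rescale_le hs (coeff_zero_normalizedSeries a) (coeff_one_normalizedSeries a)
      (norm_inv_succ_le m)).trans ?_
    rw [norm_inv_succ, add_comm, mul_comm]
    refine le_trans ?_ (Real.add_one_le_exp _)
    have := absNorm_normalizedSeries_le ha hM
    gcongr
  refine (Finset.prod_le_prod (fun _ _ => absNorm_nonneg _) hstep).trans ?_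
  rw [← Real.exp_sum, normBound, ← Finset.mul_sum]
  refine Real.exp_le_exp.2 (mul_le_mul_of_nonneg_left ?_ (by positivity))
  exact summable_inv_succ_sq.sum_le_tsum _ fun _ _ => by positivity

theorem norm_coeff_le_absNorm {F : PowerSeries ℂ} (hF : AbsSummable F) (n : ℕ) :
    ‖PowerSeries.coeff n F‖ ≤ absNorm F := hF.le_tsum n fun _ _ => norm_nonneg _

/-- The uniform norm bound excludes positive powers of `log N` in the expansion. -/
theorem tendsto_coeff_normalizedProd (ha : Summable fun s => ‖a s‖) (n : ℕ) :
    Tendsto (fun N => PowerSeries.coeff n (normalizedProd a N)) atTop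
      (𝓝 (PowerSeries.coeff n (normalizedLim a))) :=
  (logExpSeries_normalizedProd a n).tendsto_of_bounded fun N =>
    (norm_coeff_le_absNorm (absSummable_normalizedProd ha N) n).trans
      (absNorm_normalizedProd_le ha le_rfl N)

/-- Fatou's argument: finite sums of coefficients pass to the limit under the uniform bound. -/
theorem sum_norm_coeff_normalizedLim_le (ha : Summable fun s => ‖a s‖) (hM : ∑' s, ‖a s‖ ≤ M)
    (s : Finset ℕ) : ∑ n ∈ s, ‖PowerSeries.coeff n (normalizedLim a)‖ ≤ normBound M := by
  refine le_of_tendsto (tendsto_finsetSum s fun n _ => (tendsto_coeff_normalizedProd ha n).norm)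
    (Eventually.of_forall fun N => ?_)
  exact ((absSummable_normalizedProd ha N).sum_le_tsum s fun _ _ => norm_nonneg _).trans
    (absNorm_normalizedProd_le ha hM N)

theorem absSummable_normalizedLim (ha : Summable fun s => ‖a s‖) :
    AbsSummable (normalizedLim a) :=
  summable_of_sum_le (fun _ => norm_nonneg _) (sum_norm_coeff_normalizedLim_le ha le_rfl)

theorem absNorm_normalizedLim_le (ha : Summable fun s => ‖a s‖) (hM : ∑' s, ‖a s‖ ≤ M) :
    absNorm (normalizedLim a) ≤ normBound M :=
  (absSummable_normalizedLim ha).tsum_le_of_sum_le (sum_norm_coeff_normalizedLim_le ha hM)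

theorem absSummable_gammaGen (ha : Summable fun s => ‖a s‖) : AbsSummable (gammaGen a) := by
  rw [gammaGen_eq]
  exact (absSummable_normalizedLim ha).mul (absSummable_expSeries _)

theorem absNorm_gammaGen_le (ha : Summable fun s => ‖a s‖) (hM : ∑' s, ‖a s‖ ≤ M) :
    absNorm (gammaGen a) ≤ normBound M * Real.exp (M * |Real.eulerMascheroniConstant|) := by
  rw [gammaGen_eq]
  refine ((absSummable_normalizedLim ha).absNorm_mul_le (absSummable_expSeries _)).trans ?_
  rw [absNorm_expSeries, norm_mul, Complex.norm_real, Real.norm_eq_abs]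
  have h1 := absNorm_normalizedLim_le ha hM
  have h2 := (norm_le_tsum_norm ha 1).trans hM
  have h3 : 0 ≤ normBound M := (Real.exp_pos _).le
  gcongr

theorem tendsto_gammaComponent (ha : AbsSummable (gammaGen a)) :
    Tendsto (fun N => ∑ n ∈ Finset.range N, gammaComponent (kleeneStar (letters a)) n) atTop
      (𝓝 (coeffSum (gammaGen a))) := by
  have : Summable (fun n => PowerSeries.coeff n (gammaGen a)) := Summable.of_norm ha
  simpa only [coeffSum, gammaGen, PowerSeries.coeff_mk] using this.hasSum.tendsto_sum_nat

theorem kleeneStar_mem_gammaDom (ha : Summable fun s => ‖a s‖) :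
    kleeneStar (letters a) ∈ gammaDom :=
  ⟨_, tendsto_gammaComponent (absSummable_gammaGen ha)⟩

theorem gammaSeries_kleeneStar (ha : AbsSummable (gammaGen a)) :
    gammaSeries (kleeneStar (letters a)) = coeffSum (gammaGen a) :=
  (tendsto_gammaComponent ha).limUnder_eq

end Bounds

/-! ### Stability of summability, and single letters -/

theorem summable_norm_iff_absSummable {a : ℕ+ → ℂ} :
    Summable (fun s => ‖a s‖) ↔ AbsSummable (letterSeries a) := by
  refine ⟨fun ha => (hasSum_norm_coeff_letterSeries ha).summable, fun h => ?_⟩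
  have := h.comp_injective PNat.coe_injective
  exact this.congr fun s => by simp [coeff_letterSeries_pnat]

theorem summable_starLaw {a b : ℕ+ → ℂ} (ha : Summable fun s => ‖a s‖)
    (hb : Summable fun s => ‖b s‖) : Summable fun s => ‖starLaw a b s‖ := by
  rw [summable_norm_iff_absSummable] at *
  rw [letterSeries_starLaw]
  exact ha.mul hb

theorem summable_single (r : ℕ+) (c : ℂ) : Summable fun s => ‖(Pi.single r c : ℕ+ → ℂ) s‖ :=
  summable_of_ne_finset_zero (s := {r}) fun s hs => by
    simp only [Finset.mem_singleton] at hs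
    simp [hs]

theorem letterSeries_single (r : ℕ+) (c : ℂ) :
    letterSeries (Pi.single r c) = 1 + PowerSeries.monomial (r : ℕ) c := by
  ext n
  rcases Nat.eq_zero_or_pos n with rfl | hn
  · have : (0 : ℕ) ≠ r := r.ne_zero.symm
    rw [coeff_letterSeries_zero, map_add, PowerSeries.coeff_one, PowerSeries.coeff_monomial,
      if_neg this, if_pos rfl, add_zero]
  · obtain ⟨s, rfl⟩ : ∃ s : ℕ+, n = s := ⟨⟨n, hn⟩, rfl⟩
    rw [coeff_letterSeries_pnat, map_add, PowerSeries.coeff_one, PowerSeries.coeff_monomial,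
      if_neg s.ne_zero, zero_add, Pi.single_apply]
    simp

theorem letterSeries_injective : Function.Injective letterSeries := by
  intro a b h
  funext s
  rw [← coeff_letterSeries_pnat a s, h, coeff_letterSeries_pnat]

/-- Read on power series this is `(1 + c X^s)(1 + d X^r)`, which also covers coinciding letters. -/
theorem starLaw_single (r s : ℕ+) (c d : ℂ) :
    starLaw (Pi.single s c) (Pi.single r d) =
      Pi.single s c + Pi.single r d + Pi.single (s + r) (c * d) := by
  apply letterSeries_injective
  rw [letterSeries_starLaw, letterSeries_single, letterSeries_single]
  have hadd : ∀ a b : ℕ+ → ℂ, letterSeries (a + b) = letterSeries a + letterSeries b - 1 := by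
    intro a b
    ext n
    rcases eq_or_ne n 0 with rfl | hn
    · simp only [map_add, map_sub, coeff_letterSeries_zero, PowerSeries.coeff_one]
      norm_num
    · simp [coeff_letterSeries_of_ne_zero _ hn, PowerSeries.coeff_one, hn]
  rw [hadd, hadd, letterSeries_single, letterSeries_single, letterSeries_single, PNat.add_coe,
    ← PowerSeries.monomial_mul_monomial]
  ring

theorem starLaw_single_neg (s : ℕ+) (c : ℂ) :
    starLaw (Pi.single s c) (Pi.single s (-c)) = Pi.single (2 * s) (-c ^ 2) := by
  rw [starLaw_single, ← Pi.single_add, add_neg_cancel, Pi.single_zero, zero_add,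
    show s + s = 2 * s from PNat.coe_injective (by push_cast; ring)]
  congr 1
  ring

/-! ### The value of `γ` on the star of a letter -/

theorem kleeneStar_letters_scale (x : ℂ) (a : ℕ+ → ℂ) (w : Word) :
    kleeneStar (letters fun s => x ^ (s : ℕ) * a s) w =
      x ^ weight w * kleeneStar (letters a) w := by
  induction w with
  | nil => simp [kleeneStar_letters_nil]
  | cons s w ih =>
    rw [kleeneStar_letters_cons, kleeneStar_letters_cons, ih, weight_cons, pow_add]
    ring

theorem gammaGen_scale (x : ℂ) (a : ℕ+ → ℂ) :
    gammaGen (fun s => x ^ (s : ℕ) * a s) = PowerSeries.rescale x (gammaGen a) := by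
  ext n
  rw [PowerSeries.coeff_rescale, gammaGen, gammaGen, PowerSeries.coeff_mk, PowerSeries.coeff_mk,
    gammaComponent, gammaComponent, Finset.mul_sum]
  refine Finset.sum_congr rfl fun w hw => ?_
  rw [kleeneStar_letters_scale, mem_wordsOfWeight.1 hw, mul_assoc]

theorem letterSeries_scale (x : ℂ) (a : ℕ+ → ℂ) :
    letterSeries (fun s => x ^ (s : ℕ) * a s) = PowerSeries.rescale x (letterSeries a) := by
  ext n
  rw [PowerSeries.coeff_rescale]
  rcases Nat.eq_zero_or_pos n with rfl | hn
  · simp [letterSeries]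
  · obtain ⟨s, rfl⟩ : ∃ s : ℕ+, n = s := ⟨⟨n, hn⟩, rfl⟩
    rw [coeff_letterSeries_pnat, coeff_letterSeries_pnat]

theorem scale_single (x c : ℂ) (r : ℕ+) :
    (fun s : ℕ+ => x ^ (s : ℕ) * (Pi.single r c : ℕ+ → ℂ) s) =
      Pi.single r (x ^ (r : ℕ) * c) := by
  funext s
  by_cases h : s = r
  · subst h; simp
  · simp [h]

/-- Dominated convergence, with a geometric series of ratio `‖x‖` as majorant. -/
theorem tendsto_coeffSum_rescale {F : ℕ → PowerSeries ℂ} {G : PowerSeries ℂ} {B : ℝ} {x : ℂ}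
    (hx : ‖x‖ < 1) (hF : ∀ N n, ‖PowerSeries.coeff n (F N)‖ ≤ B)
    (hG : ∀ n, Tendsto (fun N => PowerSeries.coeff n (F N)) atTop (𝓝 (PowerSeries.coeff n G))) :
    Tendsto (fun N => coeffSum (PowerSeries.rescale x (F N))) atTop
      (𝓝 (coeffSum (PowerSeries.rescale x G))) := by
  refine tendsto_tsum_of_dominated_convergence (bound := fun n => ‖x‖ ^ n * B)
    ((summable_geometric_of_lt_one (norm_nonneg _) hx).mul_right B) ?_ ?_
  · intro n
    simp only [PowerSeries.coeff_rescale]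
    exact (hG n).const_mul _
  · refine Eventually.of_forall fun N n => ?_
    rw [PowerSeries.coeff_rescale, norm_mul, norm_pow]
    exact mul_le_mul_of_nonneg_left (hF N n) (by positivity)

theorem coeffSum_letterSeries_single (r : ℕ+) (c : ℂ) :
    coeffSum (letterSeries (Pi.single r c)) = 1 + c := by
  rw [coeffSum, tsum_eq_sum (s := {0, (r : ℕ)})]
  · rw [Finset.sum_pair r.ne_zero.symm, coeff_letterSeries_zero, coeff_letterSeries_pnat,
      Pi.single_eq_same]
  · intro n hn
    simp only [Finset.mem_insert, Finset.mem_singleton, not_or] at hn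
    rw [letterSeries_single, map_add, PowerSeries.coeff_one, PowerSeries.coeff_monomial,
      if_neg hn.1, if_neg hn.2, add_zero]

theorem norm_mul_inv_succ_le {z : ℂ} (hz : ‖z‖ ≤ 1) (m : ℕ) : ‖z * ((m : ℂ) + 1)⁻¹‖ ≤ 1 := by
  rw [norm_mul]
  exact mul_le_one₀ hz (norm_nonneg _) (norm_inv_succ_le m)

theorem coeffSum_normalizedProd_single (r : ℕ+) {z : ℂ} (hz : ‖z‖ ≤ 1) (N : ℕ) :
    coeffSum (PowerSeries.rescale z (normalizedProd (Pi.single r 1) N)) =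
      ∏ m ∈ Finset.range N, ((1 + (z * ((m : ℂ) + 1)⁻¹) ^ (r : ℕ)) *
        Complex.exp (-((Pi.single r 1 : ℕ+ → ℂ) 1 * (z * ((m : ℂ) + 1)⁻¹)))) := by
  rw [normalizedProd, map_prod, coeffSum_prod]
  · refine Finset.prod_congr rfl fun m _ => ?_
    rw [PowerSeries.rescale_rescale, mul_comm _ z, normalizedSeries, map_mul, ← letterSeries_scale,
      scale_single, rescale_expSeries, mul_one, AbsSummable.coeffSum_mul
        (summable_norm_iff_absSummable.1 (summable_single _ _)) (absSummable_expSeries _),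
      coeffSum_letterSeries_single, coeffSum_expSeries]
    congr 2
    ring
  · intro m _
    rw [PowerSeries.rescale_rescale, mul_comm _ z]
    exact (absSummable_normalizedSeries (summable_single r 1)).rescale (norm_mul_inv_succ_le hz m)

theorem hasSum_zeta (k : ℕ) (hk : 1 < k) :
    HasSum (fun m : ℕ => (((m : ℂ) + 1)⁻¹) ^ k) (riemannZeta k) := by
  have hs : Summable (fun n : ℕ => 1 / (n : ℂ) ^ k) := by
    refine Summable.of_norm ?_
    simpa using Real.summable_nat_pow_inv.2 hk
  have h := hs.hasSum
  rw [← zeta_nat_eq_tsum_of_gt_one hk, ← hasSum_nat_add_iff' 1] at h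
  have hk0 : k ≠ 0 := by omega
  simpa [hk0] using h

/-- The double series of logarithms that gives the functions `ell`. -/
theorem hasSum_log_series {r k₀ : ℕ} (hr : 1 ≤ r) (hk₀ : 1 ≤ k₀) (h2 : 2 ≤ r * k₀) {z : ℂ}
    (hz : ‖z‖ < 1) {g : ℕ → ℂ}
    (hg : ∀ m : ℕ, HasSum (fun j : ℕ =>
      -(-(z * ((m : ℂ) + 1)⁻¹) ^ r) ^ (j + k₀) / ((j + k₀ : ℕ) : ℂ)) (g m)) :
    HasSum g (∑' j : ℕ, -(riemannZeta ((r * (j + k₀) : ℕ) : ℂ) * (-z ^ r) ^ (j + k₀) /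
      ((j + k₀ : ℕ) : ℂ))) := by
  set t : ℕ × ℕ → ℂ := fun p =>
    -(-(z * ((p.2 : ℂ) + 1)⁻¹) ^ r) ^ (p.1 + k₀) / ((p.1 + k₀ : ℕ) : ℂ) with ht
  -- All exponents `r (j + k₀)` are at least `2`, so the double series is absolutely summable and
  -- may be summed over `m` first, giving zeta values.
  have hbound : ∀ p, ‖t p‖ ≤ ‖z‖ ^ p.1 * (((p.2 : ℝ) + 1)⁻¹) ^ 2 := by
    rintro ⟨j, m⟩
    have hj : (1 : ℝ) ≤ ((j + k₀ : ℕ) : ℝ) := by exact_mod_cast (by omega : 1 ≤ j + k₀)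
    simp only [ht]
    rw [norm_div, norm_neg, norm_pow, norm_neg, norm_pow, ← pow_mul, norm_mul, norm_inv_succ,
      mul_pow, Complex.norm_natCast]
    refine (div_le_self (by positivity) hj).trans ?_
    have hinv : ((m : ℝ) + 1)⁻¹ ≤ 1 := inv_le_one_of_one_le₀ (by simp)
    have e1 : j ≤ r * (j + k₀) := by nlinarith
    have e2 : 2 ≤ r * (j + k₀) := by nlinarith
    exact mul_le_mul (pow_le_pow_of_le_one (norm_nonneg _) hz.le e1)
      (pow_le_pow_of_le_one (by positivity) hinv e2) (by positivity) (by positivity)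
  have hsum : Summable t := Summable.of_norm_bounded
    (Summable.mul_of_nonneg (summable_geometric_of_lt_one (norm_nonneg _) hz) summable_inv_succ_sq
      (fun _ => by positivity) (fun _ => by positivity)) hbound
  have h1 : HasSum g (∑' p, t p) :=
    ((Equiv.prodComm ℕ ℕ).hasSum_iff.2 hsum.hasSum).prod_fiberwise hg
  have hrow : ∀ j : ℕ, HasSum (fun m : ℕ => t (j, m))
      (-(riemannZeta ((r * (j + k₀) : ℕ) : ℂ) * (-z ^ r) ^ (j + k₀) / ((j + k₀ : ℕ) : ℂ))) := by
    intro j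
    have hz := (hasSum_zeta (r * (j + k₀)) (by nlinarith)).mul_left
      (-((-z ^ r) ^ (j + k₀) / ((j + k₀ : ℕ) : ℂ)))
    rw [show -(riemannZeta ((r * (j + k₀) : ℕ) : ℂ) * (-z ^ r) ^ (j + k₀) / ((j + k₀ : ℕ) : ℂ)) =
      -((-z ^ r) ^ (j + k₀) / ((j + k₀ : ℕ) : ℂ)) * riemannZeta ((r * (j + k₀) : ℕ) : ℂ) by ring]
    refine hz.congr_fun fun m => ?_
    simp only [ht]
    rw [mul_pow, ← neg_mul, mul_pow, ← pow_mul _ r]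
    ring
  rw [(hsum.hasSum.prod_fiberwise hrow).tsum_eq]
  exact h1

theorem norm_pow_lt_one {u : ℂ} (hu : ‖u‖ < 1) (r : ℕ+) : ‖u ^ (r : ℕ)‖ < 1 := by
  rw [norm_pow]
  exact pow_lt_one₀ (norm_nonneg _) hu r.ne_zero

theorem norm_mul_inv_succ_lt {z : ℂ} (hz : ‖z‖ < 1) (m : ℕ) : ‖z * ((m : ℂ) + 1)⁻¹‖ < 1 := by
  rw [norm_mul]
  exact (mul_le_of_le_one_right (norm_nonneg _) (norm_inv_succ_le m)).trans_lt hz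

/-- The factor `Pi.single r 1 1` is `1` for `r = 1` and `0` otherwise: only for `r = 1` must a
divergent linear term be removed. -/
theorem hasSum_log_sub_ell (r : ℕ+) {z : ℂ} (hz : ‖z‖ < 1) :
    HasSum (fun m : ℕ => Complex.log (1 + (z * ((m : ℂ) + 1)⁻¹) ^ (r : ℕ)) -
        (Pi.single r 1 : ℕ+ → ℂ) 1 * (z * ((m : ℂ) + 1)⁻¹))
      (ell r z - (Pi.single r 1 : ℕ+ → ℂ) 1 * (Real.eulerMascheroniConstant : ℂ) * z) := by
  have hlog : ∀ m : ℕ, HasSum (fun j : ℕ =>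
      -(-(z * ((m : ℂ) + 1)⁻¹) ^ (r : ℕ)) ^ j / ((j : ℕ) : ℂ))
      (Complex.log (1 + (z * ((m : ℂ) + 1)⁻¹) ^ (r : ℕ))) := by
    intro m
    have := Complex.hasSum_taylorSeries_log (norm_pow_lt_one (norm_mul_inv_succ_lt hz m) r)
    refine this.congr_fun fun j => ?_
    rw [neg_pow]
    ring
  by_cases hr : r = 1
  · subst hr
    -- The Taylor term at `0` vanishes through division by zero, and the one at `1` is the removed
    -- linear term.
    have hg := fun m : ℕ => (hasSum_nat_add_iff' 2).2 (hlog m)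
    have h := hasSum_log_series le_rfl (by norm_num) (by norm_num) hz hg
    convert h using 1
    · funext m
      simp [Finset.sum_range_succ]
    · simp only [ell, if_true, Pi.single_eq_same, one_mul, PNat.one_coe, pow_one, tsum_neg]
      push_cast
      ring
  · have hr2 : 2 ≤ (r : ℕ) := by
      have h1 := r.pos
      have h2 : (r : ℕ) ≠ 1 := fun h => hr (PNat.coe_injective h)
      omega
    have hg := fun m : ℕ => (hasSum_nat_add_iff' 1).2 (hlog m)
    have h := hasSum_log_series (by omega) le_rfl (by omega) hz hg
    have h10 : (Pi.single r 1 : ℕ+ → ℂ) 1 = 0 := by simp [Ne.symm hr]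
    convert h using 1
    · funext m
      simp [h10]
    · rw [h10, ell, if_neg hr, tsum_neg]
      simp only [zero_mul, sub_zero]
      congr 1
      refine tsum_congr fun j => ?_
      push_cast
      rw [mul_comm (r : ℂ)]

/-- The normalised products at `z` converge both to the value of their limit series and to the
exponential of the summed logarithms; restoring the normalising exponential cancels the `γ z` term
when `r = 1`. -/
theorem coeffSum_gammaGen_single (r : ℕ+) {z : ℂ} (hz : ‖z‖ < 1) :
    coeffSum (gammaGen (Pi.single r (z ^ (r : ℕ)))) = Complex.exp (ell r z) := by
  have hs := summable_single r 1
  have h1 : Tendsto (fun N => coeffSum (PowerSeries.rescale z (normalizedProd (Pi.single r 1) N)))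
      atTop (𝓝 (coeffSum (PowerSeries.rescale z (normalizedLim (Pi.single r 1))))) :=
    tendsto_coeffSum_rescale hz (fun N n =>
      (norm_coeff_le_absNorm (absSummable_normalizedProd hs N) n).trans
        (absNorm_normalizedProd_le hs le_rfl N)) (tendsto_coeff_normalizedProd hs)
  have h2 := ((Complex.continuous_exp.tendsto _).comp
    (hasSum_log_sub_ell r hz).tendsto_sum_nat)
  have h3 : coeffSum (PowerSeries.rescale z (normalizedLim (Pi.single r 1))) =
      Complex.exp (ell r z -
        (Pi.single r 1 : ℕ+ → ℂ) 1 * (Real.eulerMascheroniConstant : ℂ) * z) := by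
    refine tendsto_nhds_unique h1 (h2.congr fun N => ?_)
    rw [coeffSum_normalizedProd_single r hz.le, Function.comp_apply, Complex.exp_sum]
    refine Finset.prod_congr rfl fun m _ => ?_
    rw [sub_eq_add_neg, Complex.exp_add, Complex.exp_log]
    intro h0
    have h := norm_pow_lt_one (norm_mul_inv_succ_lt hz m) r
    rw [eq_neg_of_add_eq_zero_right h0, norm_neg, norm_one] at h
    exact lt_irrefl _ h
  have h4 : gammaGen (Pi.single r (z ^ (r : ℕ))) =
      PowerSeries.rescale z (gammaGen (Pi.single r 1)) := by
    rw [← gammaGen_scale, scale_single, mul_one]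
  rw [h4, gammaGen_eq, map_mul, AbsSummable.coeffSum_mul
    ((absSummable_normalizedLim hs).rescale hz.le) ((absSummable_expSeries _).rescale hz.le), h3,
    rescale_expSeries, coeffSum_expSeries, ← Complex.exp_add]
  congr 1
  ring

theorem gammaSeries_single (r : ℕ+) {z : ℂ} (hz : ‖z‖ < 1) :
    gammaSeries (kleeneStar (letters (Pi.single r (z ^ (r : ℕ))))) = Complex.exp (ell r z) := by
  rw [gammaSeries_kleeneStar (absSummable_gammaGen (summable_single _ _)),
    coeffSum_gammaGen_single r hz]

/-! ### Bounds for the functions `ell` -/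

/-- A bound for the values `ζ(k)`, `k ≥ 2`. -/
def zetaBound : ℝ := ∑' m : ℕ, (((m : ℝ) + 1)⁻¹) ^ 2

theorem zetaBound_nonneg : 0 ≤ zetaBound := tsum_nonneg fun _ => by positivity

theorem norm_zeta_le {k : ℕ} (hk : 2 ≤ k) : ‖riemannZeta k‖ ≤ zetaBound := by
  rw [← (hasSum_zeta k hk).tsum_eq]
  refine tsum_of_norm_bounded summable_inv_succ_sq.hasSum fun m => ?_
  rw [norm_pow, norm_inv_succ]
  exact pow_le_pow_of_le_one (by positivity) (inv_le_one_of_one_le₀ (by simp)) hk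

theorem norm_ell_one_term_le {z : ℂ} {ρ : ℝ} (hz : ‖z‖ ≤ ρ) (k : ℕ) :
    ‖riemannZeta ((k : ℂ) + 2) * (-z) ^ (k + 2) / ((k : ℂ) + 2)‖ ≤ zetaBound * ρ ^ (k + 2) := by
  have h1 : ‖riemannZeta ((k : ℂ) + 2)‖ ≤ zetaBound := by
    exact_mod_cast norm_zeta_le (k := k + 2) (by omega)
  have h2 : (1 : ℝ) ≤ ‖(k : ℂ) + 2‖ := by
    have : ‖(k : ℂ) + 2‖ = (k : ℝ) + 2 := by exact_mod_cast Complex.norm_natCast (k + 2)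
    rw [this]; linarith [(Nat.cast_nonneg k : (0 : ℝ) ≤ k)]
  rw [norm_div, norm_mul, norm_pow, norm_neg]
  have h3 := norm_nonneg z
  exact (div_le_self (by positivity) h2).trans
    (mul_le_mul h1 (pow_le_pow_left₀ h3 hz _) (by positivity) zetaBound_nonneg)

theorem norm_ell_term_le {r : ℕ+} (hr : r ≠ 1) {z : ℂ} {ρ : ℝ} (hz : ‖z‖ ≤ ρ) (k : ℕ) :
    ‖riemannZeta (((k : ℂ) + 1) * ((r : ℕ) : ℂ)) * (-z ^ (r : ℕ)) ^ (k + 1) / ((k : ℂ) + 1)‖ ≤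
      zetaBound * (ρ ^ (r : ℕ)) ^ (k + 1) := by
  have hr2 : 2 ≤ (r : ℕ) := by
    have h1 := r.pos
    have h2 : (r : ℕ) ≠ 1 := fun h => hr (PNat.coe_injective h)
    omega
  have h1 : ‖riemannZeta (((k : ℂ) + 1) * ((r : ℕ) : ℂ))‖ ≤ zetaBound := by
    exact_mod_cast norm_zeta_le (k := (k + 1) * r) (by nlinarith)
  have h2 : (1 : ℝ) ≤ ‖(k : ℂ) + 1‖ := by
    have : ‖(k : ℂ) + 1‖ = (k : ℝ) + 1 := by exact_mod_cast Complex.norm_natCast (k + 1)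
    rw [this]; linarith [(Nat.cast_nonneg k : (0 : ℝ) ≤ k)]
  rw [norm_div, norm_mul, norm_pow, norm_neg, norm_pow]
  have h3 := norm_nonneg z
  exact (div_le_self (by positivity) h2).trans
    (mul_le_mul h1 (pow_le_pow_left₀ (by positivity) (pow_le_pow_left₀ h3 hz _) _)
      (by positivity) zetaBound_nonneg)

theorem summable_ell_bound {ρ : ℝ} (h0 : 0 ≤ ρ) (h1 : ρ < 1) (r : ℕ+) :
    Summable fun k : ℕ => zetaBound * (ρ ^ (r : ℕ)) ^ (k + 1) :=
  ((summable_nat_add_iff 1).2 (summable_geometric_of_lt_one (by positivity)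
    (pow_lt_one₀ h0 h1 r.ne_zero))).mul_left _

/-- The constant in the bound of `ell r` on the disc of radius `ρ`. -/
def ellBound (ρ : ℝ) : ℝ := |Real.eulerMascheroniConstant| + zetaBound / (1 - ρ)

/-- The factor `ρ^r`, with a constant independent of `r`, is what makes sums over `r` converge
uniformly. -/
theorem norm_ell_le {ρ : ℝ} (h1 : ρ < 1) (r : ℕ+) {z : ℂ} (hz : ‖z‖ ≤ ρ) :
    ‖ell r z‖ ≤ ellBound ρ * ρ ^ (r : ℕ) := by
  have h0 : 0 ≤ ρ := (norm_nonneg z).trans hz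
  have hZ := zetaBound_nonneg
  have hgeom := hasSum_geometric_of_lt_one h0 h1
  have h1' : 0 < 1 - ρ := by linarith
  by_cases hr : r = 1
  · subst hr
    have hs := hgeom.mul_left (zetaBound * ρ ^ 2)
    have ht := tsum_of_norm_bounded hs (f := fun k : ℕ =>
      riemannZeta ((k : ℂ) + 2) * (-z) ^ (k + 2) / ((k : ℂ) + 2)) fun k =>
        (norm_ell_one_term_le hz k).trans (le_of_eq (by ring))
    rw [ell, if_pos rfl]
    refine (norm_sub_le _ _).trans ?_
    rw [norm_mul, Complex.norm_real, Real.norm_eq_abs, ellBound, add_mul, PNat.one_coe, pow_one]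
    refine add_le_add (mul_le_mul_of_nonneg_left hz (abs_nonneg _)) (ht.trans ?_)
    rw [← div_eq_mul_inv, div_mul_eq_mul_div]
    gcongr
    nlinarith
  · have hs := hgeom.mul_left (zetaBound * ρ ^ (r : ℕ))
    have ht := tsum_of_norm_bounded hs (f := fun k : ℕ => riemannZeta (((k : ℂ) + 1) *
      ((r : ℕ) : ℂ)) * (-z ^ (r : ℕ)) ^ (k + 1) / ((k : ℂ) + 1)) fun k => by
        refine (norm_ell_term_le hr hz k).trans ?_
        rw [pow_succ, mul_assoc, mul_comm (_ ^ k), ← pow_mul]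
        refine mul_le_mul_of_nonneg_left (mul_le_mul_of_nonneg_left ?_ (by positivity)) hZ
        exact pow_le_pow_of_le_one h0 h1.le (Nat.le_mul_of_pos_left k r.pos)
    rw [ell, if_neg hr, norm_neg]
    refine ht.trans ?_
    rw [ellBound, mul_right_comm]
    refine mul_le_mul_of_nonneg_right ?_ (by positivity)
    rw [← div_eq_mul_inv]
    linarith [abs_nonneg Real.eulerMascheroniConstant]

theorem differentiableOn_ell (r : ℕ+) : DifferentiableOn ℂ (ell r) (Metric.ball 0 1) := by
  have key : ∀ ρ : ℝ, 0 ≤ ρ → ρ < 1 → DifferentiableOn ℂ (ell r) (Metric.ball 0 ρ) := by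
    intro ρ h0 h1
    have hmem : ∀ {w : ℂ}, w ∈ Metric.ball (0 : ℂ) ρ → ‖w‖ ≤ ρ := fun hw =>
      (mem_ball_zero_iff.1 hw).le
    by_cases hr : r = 1
    · subst hr
      have hs : Summable fun k : ℕ => zetaBound * ρ ^ (k + 2) :=
        ((summable_nat_add_iff 2).2 (summable_geometric_of_lt_one h0 h1)).mul_left _
      have := Complex.differentiableOn_tsum_of_summable_norm hs (F := fun (k : ℕ) (z : ℂ) =>
        riemannZeta ((k : ℂ) + 2) * (-z) ^ (k + 2) / ((k : ℂ) + 2)) (U := Metric.ball 0 ρ)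
        (fun k => by fun_prop) Metric.isOpen_ball (fun k w hw => norm_ell_one_term_le (hmem hw) k)
      have e : ell 1 = fun z => (Real.eulerMascheroniConstant : ℂ) * z -
          ∑' k : ℕ, riemannZeta ((k : ℂ) + 2) * (-z) ^ (k + 2) / ((k : ℂ) + 2) := by
        funext z; rw [ell, if_pos rfl]
      rw [e]
      exact DifferentiableOn.sub (by fun_prop) this
    · have := Complex.differentiableOn_tsum_of_summable_norm (summable_ell_bound h0 h1 r)
        (F := fun (k : ℕ) (z : ℂ) => riemannZeta (((k : ℂ) + 1) * ((r : ℕ) : ℂ)) *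
          (-z ^ (r : ℕ)) ^ (k + 1) / ((k : ℂ) + 1)) (U := Metric.ball 0 ρ)
        (fun k => by fun_prop) Metric.isOpen_ball (fun k w hw => norm_ell_term_le hr (hmem hw) k)
      have e : ell r = fun z => -∑' k : ℕ, riemannZeta (((k : ℂ) + 1) * ((r : ℕ) : ℂ)) *
          (-z ^ (r : ℕ)) ^ (k + 1) / ((k : ℂ) + 1) := by
        funext z; rw [ell, if_neg hr]
      rw [e]
      exact this.neg
  intro z hz
  rw [mem_ball_zero_iff] at hz
  have h := key ((1 + ‖z‖) / 2) (by positivity) (by linarith)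
  exact (h.differentiableAt (Metric.isOpen_ball.mem_nhds
    (mem_ball_zero_iff.2 (by linarith)))).differentiableWithinAt

theorem summable_pnat_pow {ρ : ℝ} (h0 : 0 ≤ ρ) (h1 : ρ < 1) :
    Summable fun r : ℕ+ => ρ ^ (r : ℕ) :=
  (summable_geometric_of_lt_one h0 h1).comp_injective PNat.coe_injective

/-- The sum `∑_{r ≥ 1} ℓ_r`. -/
def ellSum (z : ℂ) : ℂ := ∑' r : ℕ+, ell r z

theorem hasSum_ell {z : ℂ} (hz : ‖z‖ < 1) : HasSum (fun r => ell r z) (ellSum z) :=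
  (Summable.of_norm_bounded ((summable_pnat_pow (norm_nonneg z) hz).mul_left (ellBound ‖z‖))
    fun r => norm_ell_le hz r le_rfl).hasSum

/-! ### The infinite quasi-shuffle product -/

theorem letterSeries_zero : letterSeries 0 = 1 := by
  ext n
  rcases eq_or_ne n 0 with rfl | hn
  · simp [letterSeries]
  · simp [letterSeries, PowerSeries.coeff_one, hn]

theorem letterSeries_starLawProd (c : ℕ+ → ℂ) (k : ℕ) : letterSeries (starLawProd c k) =
    ∏ r ∈ Finset.range k, letterSeries (Pi.single r.succPNat (c r.succPNat)) := by
  induction k with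
  | zero => simp [starLawProd, letterSeries_zero]
  | succ k ih => rw [starLawProd, letterSeries_starLaw, ih, Finset.prod_range_succ]

theorem summable_starLawProd (c : ℕ+ → ℂ) (k : ℕ) : Summable fun s => ‖starLawProd c k s‖ := by
  induction k with
  | zero => simp [starLawProd]
  | succ k ih => exact summable_starLaw ih (summable_single _ _)

theorem absNorm_letterSeries_single (r : ℕ+) (c : ℂ) :
    absNorm (letterSeries (Pi.single r c)) = 1 + ‖c‖ := by
  rw [absNorm, (hasSum_norm_coeff_letterSeries (summable_single r c)).tsum_eq, tsum_eq_single r]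
  · simp
  · intro s hs
    simp [hs]

/-- Submultiplicativity of the norm gives `∏ (1 + |c_r|) ≤ exp(∑ |c_r|)`, uniformly in the number of
factors. -/
theorem tsum_norm_starLawProd_le {c : ℕ+ → ℂ} (hc : Summable fun s => ‖c s‖) (k : ℕ) :
    ∑' s, ‖starLawProd c k s‖ ≤ Real.exp (∑' s, ‖c s‖) := by
  have h1 : absNorm (letterSeries (starLawProd c k)) = 1 + ∑' s, ‖starLawProd c k s‖ :=
    (hasSum_norm_coeff_letterSeries (summable_starLawProd c k)).tsum_eq
  have h2 : absNorm (letterSeries (starLawProd c k)) ≤ Real.exp (∑' s, ‖c s‖) := by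
    rw [letterSeries_starLawProd]
    refine (absNorm_prod_le _ fun r _ =>
      summable_norm_iff_absSummable.1 (summable_single _ _)).trans ?_
    simp only [absNorm_letterSeries_single]
    refine (Finset.prod_le_prod (fun _ _ => by positivity) fun r _ =>
      (add_comm (1 : ℝ) _).le.trans (Real.add_one_le_exp ‖c r.succPNat‖)).trans ?_
    rw [← Real.exp_sum]
    refine Real.exp_le_exp.2 ?_
    rw [← Finset.sum_image (s := Finset.range k) (g := Nat.succPNat) (f := fun s => ‖c s‖)
      (fun x _ y _ h => Nat.succPNat_injective h)]
    exact hc.sum_le_tsum _ fun _ _ => norm_nonneg _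
  linarith

theorem coeff_gammaGen_starLawProd (c : ℕ+ → ℂ) {n k : ℕ} (hk : n ≤ k) :
    PowerSeries.coeff n (gammaGen (starLawProd c k)) =
      PowerSeries.coeff n (gammaGen (starLawLim c)) := by
  rw [gammaGen, gammaGen, PowerSeries.coeff_mk, PowerSeries.coeff_mk, gammaComponent,
    gammaComponent]
  refine Finset.sum_congr rfl fun w hw => ?_
  rw [mem_wordsOfWeight] at hw
  rw [kleeneStar_letters_congr fun s hs =>
    starLawProd_apply_of_le c s (hs.trans (hw.trans_le hk))]
  rfl

theorem starLawProd_scale (x : ℂ) (c : ℕ+ → ℂ) (k : ℕ) :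
    starLawProd (fun s => x ^ (s : ℕ) * c s) k =
      fun s : ℕ+ => x ^ (s : ℕ) * starLawProd c k s := by
  apply letterSeries_injective
  rw [letterSeries_scale, letterSeries_starLawProd, letterSeries_starLawProd, map_prod]
  refine Finset.prod_congr rfl fun r _ => ?_
  rw [← letterSeries_scale, scale_single]

theorem coeffSum_gammaGen_starLawProd {z : ℂ} (hz : ‖z‖ < 1) (k : ℕ) :
    coeffSum (gammaGen (starLawProd (fun r => z ^ (r : ℕ)) k)) =
      ∏ r ∈ Finset.range k, Complex.exp (ell r.succPNat z) := by
  induction k with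
  | zero =>
    have h : gammaGen 0 = 1 := by
      refine (logExpSeries_harmonicSeries 0).unique fun n => ?_
      simp only [harmonicSeries, letterSeries_zero, map_one, Finset.prod_const_one]
      exact LogExp.const _
    simp [starLawProd, h, coeffSum_one]
  | succ k ih =>
    rw [starLawProd, gammaGen_starLaw, AbsSummable.coeffSum_mul
      (absSummable_gammaGen (summable_starLawProd _ k))
      (absSummable_gammaGen (summable_single _ _)), ih, Finset.prod_range_succ,
      coeffSum_gammaGen_single _ hz]

/-- Bounds at a radius `ρ` strictly between `‖z‖` and `1` become geometric decay after rescaling by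
`x = z/ρ`, which allows exchanging the limit of partial products with the sum over weights. -/
theorem gammaGen_starLawLim {z : ℂ} (hz : ‖z‖ < 1) :
    AbsSummable (gammaGen (starLawLim fun r => z ^ (r : ℕ))) ∧
      coeffSum (gammaGen (starLawLim fun r => z ^ (r : ℕ))) = Complex.exp (ellSum z) := by
  set ρ : ℝ := (1 + ‖z‖) / 2 with hρ
  have hz0 := norm_nonneg z
  have hρ0 : 0 < ρ := by positivity
  have hρ1 : ρ < 1 := by rw [hρ]; linarith
  have hzρ : ‖z‖ < ρ := by rw [hρ]; linarith
  set x : ℂ := z / ρ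
  have hx : ‖x‖ < 1 := by
    rw [norm_div, Complex.norm_real, Real.norm_of_nonneg hρ0.le]
    exact (div_lt_one hρ0).2 hzρ
  set c : ℕ+ → ℂ := fun r => (ρ : ℂ) ^ (r : ℕ) with hc
  have hcs : Summable fun s => ‖c s‖ := by
    refine (summable_pnat_pow hρ0.le hρ1).congr fun s => ?_
    rw [hc, norm_pow, Complex.norm_real, Real.norm_of_nonneg hρ0.le]
  have hxc : (fun r : ℕ+ => z ^ (r : ℕ)) = fun r : ℕ+ => x ^ (r : ℕ) * c r := by
    funext r
    have : (ρ : ℂ) ≠ 0 := by exact_mod_cast hρ0.ne'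
    rw [hc, ← mul_pow, div_mul_cancel₀ _ this]
  have hlim : starLawLim (fun r => z ^ (r : ℕ)) = fun s : ℕ+ => x ^ (s : ℕ) * starLawLim c s := by
    funext s
    rw [hxc, starLawLim, starLawProd_scale, starLawLim]
  obtain ⟨B, hB⟩ : ∃ B, ∀ k n, ‖PowerSeries.coeff n (gammaGen (starLawProd c k))‖ ≤ B :=
    ⟨_, fun k n => (norm_coeff_le_absNorm (absSummable_gammaGen (summable_starLawProd c k)) n).trans
      (absNorm_gammaGen_le (summable_starLawProd c k) (tsum_norm_starLawProd_le hcs k))⟩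
  constructor
  · rw [hlim, gammaGen_scale]
    refine Summable.of_nonneg_of_le (fun _ => norm_nonneg _) (fun n => ?_)
      ((summable_geometric_of_lt_one (norm_nonneg x) hx).mul_right B)
    -- The coefficient of degree `n` of the limit is already that of the partial product with `n`
    -- factors.
    rw [PowerSeries.coeff_rescale, norm_mul, norm_pow, ← coeff_gammaGen_starLawProd c le_rfl]
    exact mul_le_mul_of_nonneg_left (hB n n) (by positivity)
  · have h1 := tendsto_coeffSum_rescale (G := gammaGen (starLawLim c)) hx hB fun n =>
      tendsto_const_nhds.congr' (by
        filter_upwards [eventually_ge_atTop n] with k hk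
        exact (coeff_gammaGen_starLawProd c hk).symm)
    rw [hlim, gammaGen_scale]
    refine tendsto_nhds_unique h1 ?_
    have h2 : HasSum (fun r : ℕ => ell r.succPNat z) (ellSum z) :=
      (Equiv.pnatEquivNat.symm.hasSum_iff (f := fun r => ell r z)).2 (hasSum_ell hz)
    refine ((Complex.continuous_exp.tendsto _).comp h2.tendsto_sum_nat).congr fun k => ?_
    rw [Function.comp_apply, Complex.exp_sum, ← coeffSum_gammaGen_starLawProd hz, hxc,
      starLawProd_scale, gammaGen_scale]

/-! ### Iterated integrals -/

theorem hasSum_word_cons {E : Type*} [NormedAddCommGroup E] {f : Word → E} {x : E}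
    (h0 : f [] = 0) (h : HasSum (fun p : ℕ+ × Word => f (p.1 :: p.2)) x) : HasSum f x := by
  have hinj : Function.Injective (fun p : ℕ+ × Word => p.1 :: p.2) := by
    rintro ⟨s, w⟩ ⟨t, v⟩ h
    simpa using h
  refine (hinj.hasSum_iff fun w hw => ?_).1 h
  cases w with
  | nil => exact h0
  | cons s w => exact absurd ⟨(s, w), rfl⟩ hw

theorem prod_map_nonneg {C : ℕ+ → ℝ} (hC : ∀ s, 0 ≤ C s) (w : Word) : 0 ≤ (w.map C).prod :=
  List.prod_nonneg (by simpa using fun s _ => hC s)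

theorem length_indicator_nonneg {C : ℕ+ → ℝ} (hC : ∀ s, 0 ≤ C s) (k : ℕ) (w : Word) :
    0 ≤ if w.length = k then (w.map C).prod else 0 := by
  split_ifs
  · exact prod_map_nonneg hC w
  · exact le_rfl

/-- The sum over the words of length `k` of a product over the letters. -/
theorem hasSum_length {C : ℕ+ → ℝ} (hC : ∀ s, 0 ≤ C s) (hs : Summable C) (k : ℕ) :
    HasSum (fun w : Word => if w.length = k then (w.map C).prod else 0) ((∑' s, C s) ^ k) := by
  induction k with
  | zero =>
    rw [pow_zero]
    refine (hasSum_ite_eq ([] : Word) (1 : ℝ)).congr_fun fun w => ?_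
    cases w <;> simp
  | succ k ih =>
    apply hasSum_word_cons (by simp)
    have hnonneg := length_indicator_nonneg hC k
    have h := HasSum.mul (f := C) (g := fun w : Word => if w.length = k then (w.map C).prod else 0)
      hs.hasSum ih (Summable.mul_of_nonneg (f := C)
        (g := fun w : Word => if w.length = k then (w.map C).prod else 0) hs ih.summable hC hnonneg)
    rw [← pow_succ'] at h
    exact h.congr_fun fun p => by simp

section Path

variable {z : ℂ}

/-- The integrand `ω_s` along the segment from `0` to `z`. -/
def pathForm (z : ℂ) (s : ℕ+) (x : ℝ) : ℂ := deriv (ell s) ((x : ℂ) * z) * z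

theorem norm_path_le {x : ℝ} (hx : x ∈ Set.Icc (0 : ℝ) 1) (z : ℂ) : ‖(x : ℂ) * z‖ ≤ ‖z‖ := by
  rw [norm_mul, Complex.norm_real, Real.norm_of_nonneg hx.1]
  exact mul_le_of_le_one_left (norm_nonneg _) hx.2

theorem continuous_path (z : ℂ) : Continuous fun x : ℝ => (x : ℂ) * z := by fun_prop

theorem continuousOn_pathForm (hz : ‖z‖ < 1) (s : ℕ+) :
    ContinuousOn (pathForm z s) (Set.Icc 0 1) := by
  have h := ((differentiableOn_ell s).deriv Metric.isOpen_ball).continuousOn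
  refine (h.comp (continuous_path z).continuousOn fun x hx => ?_).mul continuousOn_const
  exact mem_ball_zero_iff.2 ((norm_path_le hx z).trans_lt hz)

/-- Cauchy's estimate on discs of radius `ρ - ‖z‖` about the segment transfers the decay `ρ^s` from
`ell s` to its derivative. -/
theorem exists_pathForm_bound (hz : ‖z‖ < 1) : ∃ C : ℕ+ → ℝ, (∀ s, 0 ≤ C s) ∧ Summable C ∧
    ∀ s, ∀ x ∈ Set.Icc (0 : ℝ) 1, ‖pathForm z s x‖ ≤ C s := by
  obtain ⟨ρ, hzρ, hρ1⟩ := exists_between hz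
  have hρ0 : 0 ≤ ρ := (norm_nonneg z).trans hzρ.le
  have hR : 0 < ρ - ‖z‖ := by linarith
  have hbound : ∀ s, ∀ x ∈ Set.Icc (0 : ℝ) 1,
      ‖pathForm z s x‖ ≤ ellBound ρ / (ρ - ‖z‖) * ρ ^ (s : ℕ) := by
    intro s x hx
    have hxz := norm_path_le hx z
    have hsub : ∀ u ∈ Metric.closedBall ((x : ℂ) * z) (ρ - ‖z‖), ‖u‖ ≤ ρ := by
      intro u hu
      have h1 : ‖u - x * z‖ ≤ ρ - ‖z‖ := mem_closedBall_iff_norm.1 hu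
      have h2 := norm_add_le (u - x * z) (x * z)
      rw [sub_add_cancel] at h2
      linarith
    have hd : DiffContOnCl ℂ (ell s) (Metric.ball ((x : ℂ) * z) (ρ - ‖z‖)) := by
      refine ((differentiableOn_ell s).mono fun u hu => ?_).diffContOnCl
      exact mem_ball_zero_iff.2 ((hsub u (Metric.closure_ball_subset_closedBall hu)).trans_lt hρ1)
    have h := Complex.norm_deriv_le_of_forall_mem_sphere_norm_le hR hd (fun u hu =>
      norm_ell_le hρ1 s (hsub u (Metric.sphere_subset_closedBall hu)))
    rw [pathForm, norm_mul]
    calc ‖deriv (ell s) (x * z)‖ * ‖z‖ ≤ ‖deriv (ell s) (x * z)‖ * 1 := by gcongr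
      _ ≤ ellBound ρ / (ρ - ‖z‖) * ρ ^ (s : ℕ) := by
        rw [mul_one, div_mul_eq_mul_div]; exact h
  refine ⟨_, fun s => (norm_nonneg _).trans (hbound s 0 (by simp)),
    (summable_pnat_pow hρ0 hρ1).mul_left _, hbound⟩

theorem ell_zero (s : ℕ+) : ell s 0 = 0 := by
  -- The bound is applied with `ρ = 0`, where `ρ^s` vanishes.
  have := norm_ell_le (zero_lt_one) s (z := 0) (by simp)
  simpa using this

theorem ellSum_zero : ellSum 0 = 0 := by simp [ellSum, ell_zero]

theorem differentiableOn_ellSum : DifferentiableOn ℂ ellSum (Metric.ball 0 1) := by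
  intro u hu
  obtain ⟨ρ, huρ, hρ1⟩ := exists_between (mem_ball_zero_iff.1 hu)
  have hs := (summable_pnat_pow ((norm_nonneg u).trans huρ.le) hρ1).mul_left (ellBound ρ)
  exact ((Complex.differentiableOn_tsum_of_summable_norm hs
    (fun r => (differentiableOn_ell r).mono (Metric.ball_subset_ball hρ1.le)) Metric.isOpen_ball
    (fun r w hw => norm_ell_le hρ1 r (mem_ball_zero_iff.1 hw).le)).differentiableAt
      (Metric.isOpen_ball.mem_nhds (mem_ball_zero_iff.2 huρ))).differentiableWithinAt

theorem hasSum_pathForm (hz : ‖z‖ < 1) {x : ℝ} (hx : x ∈ Set.Icc (0 : ℝ) 1) :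
    HasSum (fun s => pathForm z s x) (deriv ellSum ((x : ℂ) * z) * z) ∧
      HasDerivAt (fun x : ℝ => ellSum ((x : ℂ) * z)) (deriv ellSum ((x : ℂ) * z) * z) x := by
  obtain ⟨ρ, hzρ, hρ1⟩ := exists_between hz
  have hρ0 : 0 ≤ ρ := (norm_nonneg z).trans hzρ.le
  have hmem : (x : ℂ) * z ∈ Metric.ball (0 : ℂ) ρ :=
    mem_ball_zero_iff.2 ((norm_path_le hx z).trans_lt hzρ)
  have hs := (summable_pnat_pow hρ0 hρ1).mul_left (ellBound ρ)
  have hd : ∀ r, DifferentiableOn ℂ (ell r) (Metric.ball 0 ρ) := fun r =>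
    (differentiableOn_ell r).mono (Metric.ball_subset_ball hρ1.le)
  have hle : ∀ (r : ℕ+) (w : ℂ), w ∈ Metric.ball (0 : ℂ) ρ → ‖ell r w‖ ≤ ellBound ρ * ρ ^ (r : ℕ) :=
    fun r w hw => norm_ell_le hρ1 r (mem_ball_zero_iff.1 hw).le
  constructor
  · exact (Complex.hasSum_deriv_of_summable_norm hs hd Metric.isOpen_ball hle hmem).mul_right z
  · have h1 : DifferentiableAt ℂ ellSum ((x : ℂ) * z) :=
      differentiableOn_ellSum.differentiableAt (Metric.isOpen_ball.mem_nhds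
        (Metric.ball_subset_ball hρ1.le hmem))
    have h2 : HasDerivAt (fun x : ℂ => x * z) z (x : ℂ) := by
      simpa using (hasDerivAt_id (x : ℂ)).mul_const z
    exact (h1.hasDerivAt.comp (x : ℂ) h2).comp_ofReal

/-- Substitution turns the integral over the unit interval into one with moving endpoint along a
fixed segment, so that all words share the same path. -/
theorem alphaWord_path_cons (s : ℕ+) (w : Word) (t : ℝ) :
    alphaWord (s :: w) ((t : ℂ) * z) =
      ∫ x in (0 : ℝ)..t, pathForm z s x * alphaWord w ((x : ℂ) * z) := by
  have h := intervalIntegral.smul_integral_comp_mul_right (a := 0) (b := 1)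
    (fun x : ℝ => pathForm z s x * alphaWord w ((x : ℂ) * z)) t
  rw [zero_mul, one_mul] at h
  rw [← h, alphaWord, ← intervalIntegral.integral_smul]
  refine intervalIntegral.integral_congr fun x _ => ?_
  simp only [pathForm, Complex.ofReal_mul, Complex.real_smul, mul_assoc]
  ring

theorem continuousOn_alphaWord_path (hz : ‖z‖ < 1) (w : Word) :
    ContinuousOn (fun t : ℝ => alphaWord w ((t : ℂ) * z)) (Set.Icc 0 1) := by
  induction w with
  | nil => simpa [alphaWord] using continuousOn_const
  | cons s w ih =>
    simp only [alphaWord_path_cons]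
    have h := ((continuousOn_pathForm hz s).mul ih).integrableOn_Icc
      (μ := MeasureTheory.volume)
    rw [← Set.uIcc_of_le zero_le_one] at h ⊢
    exact intervalIntegral.continuousOn_primitive_interval h

/-- The factor `t^k / k!` is the volume of the simplex of integration; it makes the sum over all
words converge. -/
theorem norm_alphaWord_path_le {C : ℕ+ → ℝ} (hC0 : ∀ s, 0 ≤ C s)
    (hC : ∀ s, ∀ x ∈ Set.Icc (0 : ℝ) 1, ‖pathForm z s x‖ ≤ C s) (w : Word) {t : ℝ}
    (ht : t ∈ Set.Icc (0 : ℝ) 1) :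
    ‖alphaWord w ((t : ℂ) * z)‖ ≤ (w.map C).prod * (t ^ w.length / w.length.factorial) := by
  induction w generalizing t with
  | nil => simp [alphaWord]
  | cons s w ih =>
    rw [alphaWord_path_cons]
    have hint : ∫ x in (0 : ℝ)..t, C s * ((w.map C).prod * (x ^ w.length / w.length.factorial)) =
        ((s :: w).map C).prod * (t ^ (s :: w).length / (s :: w).length.factorial) := by
      rw [intervalIntegral.integral_const_mul, intervalIntegral.integral_const_mul,
        intervalIntegral.integral_div, integral_pow]
      simp only [List.map_cons, List.prod_cons, List.length_cons, Nat.factorial_succ]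
      push_cast
      have h1 : (w.length.factorial : ℝ) ≠ 0 := by positivity
      have h2 : (w.length : ℝ) + 1 ≠ 0 := by positivity
      field_simp
      simp
    rw [← hint]
    refine intervalIntegral.norm_integral_le_of_norm_le ht.1 ?_ (by
      apply Continuous.intervalIntegrable; fun_prop)
    refine Eventually.of_forall fun x hx => ?_
    have hx' : x ∈ Set.Icc (0 : ℝ) 1 := ⟨hx.1.le, hx.2.trans ht.2⟩
    rw [norm_mul]
    exact mul_le_mul (hC s x hx') (ih hx') (norm_nonneg _) (hC0 s)

theorem integral_deriv_ellSum_pow (hz : ‖z‖ < 1) (k : ℕ) {t : ℝ} (ht : t ∈ Set.Icc (0 : ℝ) 1) :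
    ∫ x in (0 : ℝ)..t, deriv ellSum ((x : ℂ) * z) * z *
        (ellSum ((x : ℂ) * z) ^ k / k.factorial) =
      ellSum ((t : ℂ) * z) ^ (k + 1) / (k + 1).factorial := by
  have hfac : (k.factorial : ℂ) ≠ 0 := by exact_mod_cast Nat.factorial_ne_zero k
  have hk : (k : ℂ) + 1 ≠ 0 := by exact_mod_cast Nat.succ_ne_zero k
  have hsub : Set.uIcc 0 t ⊆ Set.Icc (0 : ℝ) 1 := by
    rw [Set.uIcc_of_le ht.1]
    exact Set.Icc_subset_Icc_right ht.2
  rw [intervalIntegral.integral_eq_sub_of_hasDerivAt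
    (f := fun x : ℝ => ellSum ((x : ℂ) * z) ^ (k + 1) / (k + 1).factorial)]
  · simp [ellSum_zero]
  · intro x hx
    refine (((hasSum_pathForm hz (hsub hx)).2.fun_pow (k + 1)).div_const
      ((k + 1).factorial : ℂ)).congr_deriv ?_
    rw [Nat.factorial_succ]
    push_cast
    field_simp
  · apply ContinuousOn.intervalIntegrable
    have hmaps : Set.MapsTo (fun x : ℝ => (x : ℂ) * z) (Set.uIcc 0 t)
        (Metric.ball (0 : ℂ) 1) := fun x hx =>
      mem_ball_zero_iff.2 ((norm_path_le (hsub hx) z).trans_lt hz)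
    have hd := (differentiableOn_ellSum.deriv Metric.isOpen_ball).continuousOn
    exact ((hd.comp (continuous_path z).continuousOn hmaps).mul continuousOn_const).mul
      (((differentiableOn_ellSum.continuousOn.comp (continuous_path z).continuousOn
        hmaps).pow k).div_const _)

theorem summable_cons_bound {C : ℕ+ → ℝ} (hC : ∀ s, 0 ≤ C s) (hs : Summable C) (k : ℕ) :
    Summable fun p : ℕ+ × Word => C p.1 * if p.2.length = k then (p.2.map C).prod else 0 :=
  Summable.mul_of_nonneg (g := fun w : Word => if w.length = k then (w.map C).prod else 0)
    hs (hasSum_length hC hs k).summable hC (length_indicator_nonneg hC k)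

theorem continuousOn_alphaWord_cons (hz : ‖z‖ < 1) (k : ℕ) (p : ℕ+ × Word) :
    ContinuousOn (fun x : ℝ => pathForm z p.1 x *
      if p.2.length = k then alphaWord p.2 ((x : ℂ) * z) else 0) (Set.Icc 0 1) := by
  refine (continuousOn_pathForm hz p.1).mul ?_
  by_cases hp : p.2.length = k
  · simpa only [hp, if_true] using continuousOn_alphaWord_path hz p.2
  · simpa only [hp, if_false] using continuousOn_const

theorem norm_alphaWord_cons_le {C : ℕ+ → ℝ} (hC0 : ∀ s, 0 ≤ C s)
    (hC : ∀ s, ∀ x ∈ Set.Icc (0 : ℝ) 1, ‖pathForm z s x‖ ≤ C s) (k : ℕ) (p : ℕ+ × Word) {x : ℝ}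
    (hx : x ∈ Set.Icc (0 : ℝ) 1) :
    ‖pathForm z p.1 x * if p.2.length = k then alphaWord p.2 ((x : ℂ) * z) else 0‖ ≤
      C p.1 * if p.2.length = k then (p.2.map C).prod else 0 := by
  rw [norm_mul]
  refine mul_le_mul (hC _ x hx) ?_ (norm_nonneg _) (hC0 _)
  split_ifs with hw
  · refine (norm_alphaWord_path_le hC0 hC p.2 hx).trans
      (mul_le_of_le_one_right (prod_map_nonneg hC0 p.2) ?_)
    exact div_le_one_of_le₀ ((pow_le_one₀ hx.1 hx.2).trans
      (by exact_mod_cast Nat.factorial_pos _)) (by positivity)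
  · simp

/-- Summing over the first letter replaces `ω_s` by `d(∑ ℓ_s)`, so the length-`k` part satisfies the
recursion of `L^k / k!` with `L = ellSum`; dominated convergence exchanges sum and integral. -/
theorem hasSum_alphaWord_length (hz : ‖z‖ < 1) (k : ℕ) {t : ℝ} (ht : t ∈ Set.Icc (0 : ℝ) 1) :
    HasSum (fun w : Word => if w.length = k then alphaWord w ((t : ℂ) * z) else 0)
      (ellSum ((t : ℂ) * z) ^ k / k.factorial) := by
  obtain ⟨C, hC0, hCs, hC⟩ := exists_pathForm_bound hz
  induction k generalizing t with
  | zero =>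
    rw [pow_zero, Nat.factorial_zero, Nat.cast_one, div_one]
    refine (hasSum_ite_eq ([] : Word) (1 : ℂ)).congr_fun fun w => ?_
    cases w <;> simp [alphaWord]
  | succ k ih =>
    apply hasSum_word_cons (by simp)
    have hprod := summable_cons_bound hC0 hCs k
    have hIoc : ∀ {x : ℝ}, x ∈ Set.uIoc 0 t → x ∈ Set.Icc (0 : ℝ) 1 := by
      intro x hx
      rw [Set.uIoc_of_le ht.1] at hx
      exact ⟨hx.1.le, hx.2.trans ht.2⟩
    have hmain := intervalIntegral.hasSum_integral_of_dominated_convergence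
      (μ := MeasureTheory.volume) (a := 0) (b := t)
      (F := fun (p : ℕ+ × Word) (x : ℝ) =>
        pathForm z p.1 x * if p.2.length = k then alphaWord p.2 ((x : ℂ) * z) else 0)
      (f := fun x : ℝ => deriv ellSum ((x : ℂ) * z) * z *
        (ellSum ((x : ℂ) * z) ^ k / k.factorial))
      (fun p _ => C p.1 * if p.2.length = k then (p.2.map C).prod else 0) ?_
      (fun p => Eventually.of_forall fun x hx => norm_alphaWord_cons_le hC0 hC k p (hIoc hx))
      (Eventually.of_forall fun x _ => hprod) (by simp)
      (Eventually.of_forall fun x hx => ?_)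
    · rw [integral_deriv_ellSum_pow hz k ht] at hmain
      refine hmain.congr_fun fun p => ?_
      rw [List.length_cons]
      by_cases hp : p.2.length = k
      · simp only [hp, if_true, alphaWord_path_cons]
      · simp [hp]
    · intro p
      refine ContinuousOn.aestronglyMeasurable (fun x hx => ?_) measurableSet_uIoc
      exact (continuousOn_alphaWord_cons hz k p x (hIoc hx)).mono fun y hy => hIoc hy
    · have hx' := hIoc hx
      have hAB : Summable fun p : ℕ+ × Word =>
          pathForm z p.1 x * if p.2.length = k then alphaWord p.2 ((x : ℂ) * z) else 0 :=
        Summable.of_norm_bounded hprod fun p => norm_alphaWord_cons_le hC0 hC k p hx'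
      exact HasSum.mul (f := fun s => pathForm z s x)
        (g := fun w : Word => if w.length = k then alphaWord w ((x : ℂ) * z) else 0)
        (hasSum_pathForm hz hx').1 (ih hx') hAB

theorem summable_length_bound {C : ℕ+ → ℝ} (hC : ∀ s, 0 ≤ C s) (hs : Summable C) :
    Summable fun p : ℕ × Word =>
      (if p.2.length = p.1 then (p.2.map C).prod else 0) * ((p.1.factorial : ℝ))⁻¹ := by
  set b : ℕ × Word → ℝ := fun p =>
    (if p.2.length = p.1 then (p.2.map C).prod else 0) * ((p.1.factorial : ℝ))⁻¹ with hb
  have hnonneg : 0 ≤ b := fun p =>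
    mul_nonneg (length_indicator_nonneg hC p.1 p.2) (inv_nonneg.2 (Nat.cast_nonneg _))
  have hrow : ∀ k : ℕ, HasSum (fun w => b (k, w)) ((∑' s, C s) ^ k * ((k.factorial : ℝ))⁻¹) :=
    fun k => (hasSum_length hC hs k).mul_right ((k.factorial : ℝ))⁻¹
  have hcol : (fun k => ∑' w, b (k, w)) = fun k : ℕ => (∑' s, C s) ^ k / (k.factorial : ℝ) :=
    funext fun k => (hrow k).tsum_eq.trans (div_eq_mul_inv _ _).symm
  refine (summable_prod_of_nonneg hnonneg).2 ⟨fun k => (hrow k).summable, ?_⟩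
  rw [hcol]
  exact Real.summable_pow_div_factorial _

theorem summable_length_alphaWord (hz : ‖z‖ < 1) :
    Summable fun p : ℕ × Word => if p.2.length = p.1 then alphaWord p.2 z else 0 := by
  obtain ⟨C, hC0, hCs, hC⟩ := exists_pathForm_bound hz
  have hb := summable_length_bound hC0 hCs
  refine Summable.of_norm_bounded hb fun p => ?_
  by_cases hp : p.2.length = p.1
  · simp only [hp, if_true]
    have := norm_alphaWord_path_le hC0 hC p.2 (t := 1) (by simp)
    rw [Complex.ofReal_one, one_mul, one_pow, hp, one_div] at this
    exact this
  · simp only [hp, if_false, norm_zero, zero_mul, le_refl]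

theorem hasSum_alphaWord (hz : ‖z‖ < 1) :
    HasSum (fun w : Word => alphaWord w z) (Complex.exp (ellSum z)) := by
  have hrow : ∀ k : ℕ, HasSum (fun w : Word => if w.length = k then alphaWord w z else 0)
      (ellSum z ^ k / k.factorial) := fun k => by
    have h := hasSum_alphaWord_length hz k (t := 1) (by simp)
    rwa [Complex.ofReal_one, one_mul] at h
  have hexp := NormedSpace.expSeries_div_hasSum_exp (ellSum z)
  rw [← Complex.exp_eq_exp_ℂ] at hexp
  have htot := (summable_length_alphaWord hz).hasSum
  rw [(htot.prod_fiberwise hrow).unique hexp] at htot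
  -- The absolutely convergent family over pairs `(k, w)`, summed over `k` as the exponential
  -- series, is now regrouped by `w`, where only `k = w.length` contributes.
  refine ((Equiv.prodComm Word ℕ).hasSum_iff.2 htot).prod_fiberwise fun w => ?_
  refine (hasSum_ite_eq w.length (alphaWord w z)).congr_fun fun k => ?_
  simp [eq_comm]

end Path

end EulerianStars

end

/-! ### The main theorem -/

theorem mainTheorem10 :
    (∀ w : Word, HasFinitePart (harmonicSum w) (gammaWord w)) ∧
    (∀ z : ℂ, ‖z‖ < 1 →
      (∀ r : ℕ+, kleeneStar (letters (Pi.single r (z ^ (r : ℕ)))) ∈ gammaDom) ∧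
      ∃ S T : Series,
        IsInfiniteProduct stuffle (fun r => kleeneStar (letters (Pi.single r (z ^ (r : ℕ))))) S ∧
        IsInfiniteProduct shuffle (fun r => kleeneStar (letters (Pi.single r 1))) T ∧
        S ∈ gammaDom ∧
        HasProd (fun r : ℕ+ => gammaSeries (kleeneStar (letters (Pi.single r (z ^ (r : ℕ))))))
          (gammaSeries S) ∧
        HasProd (fun r : ℕ+ => Complex.exp (ell r z)) (gammaSeries S) ∧
        HasProd (fun r : ℕ+ => 1 / GammaY r (1 + z)) (gammaSeries S) ∧
        HasSum (fun w : Word => T w * alphaWord w z) (gammaSeries S)) ∧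
    (∀ a b : ℕ+ → ℂ, Summable (fun s => ‖a s‖) → Summable (fun s => ‖b s‖) →
      kleeneStar (letters a) ∈ gammaDom ∧ kleeneStar (letters b) ∈ gammaDom ∧
      kleeneStar (letters (starLaw a b)) ∈ gammaDom ∧
      gammaSeries (kleeneStar (letters (starLaw a b))) =
        gammaSeries (kleeneStar (letters a)) * gammaSeries (kleeneStar (letters b))) ∧
    (∀ a b : ℕ+ → ℂ, kleeneStar (letters a) ∈ gammaDom → kleeneStar (letters b) ∈ gammaDom →
      kleeneStar (letters (starLaw a b)) ∈ gammaDom →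
      gammaSeries (kleeneStar (letters (starLaw a b))) =
        gammaSeries (kleeneStar (letters a)) * gammaSeries (kleeneStar (letters b))) ∧
    (∀ (r s : ℕ+) (c d : ℂ),
      kleeneStar (letters (Pi.single s c + Pi.single r d + Pi.single (s + r) (c * d))) ∈ gammaDom ∧
      kleeneStar (letters (Pi.single s c)) ∈ gammaDom ∧ kleeneStar (letters (Pi.single r d)) ∈ gammaDom ∧
      gammaSeries
          (kleeneStar (letters (Pi.single s c + Pi.single r d + Pi.single (s + r) (c * d)))) =
        gammaSeries (kleeneStar (letters (Pi.single s c))) *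
          gammaSeries (kleeneStar (letters (Pi.single r d)))) ∧
    (∀ (s : ℕ+) (c : ℂ),
      kleeneStar (letters (Pi.single (2 * s) (-c ^ 2))) ∈ gammaDom ∧
      kleeneStar (letters (Pi.single s c)) ∈ gammaDom ∧ kleeneStar (letters (Pi.single s (-c))) ∈ gammaDom ∧
      gammaSeries (kleeneStar (letters (Pi.single (2 * s) (-c ^ 2)))) =
        gammaSeries (kleeneStar (letters (Pi.single s c))) *
          gammaSeries (kleeneStar (letters (Pi.single s (-c))))) := by
  refine ⟨hasFinitePart_gammaWord, ?_, ?_, fun a b => gammaSeries_starLaw, ?_, ?_⟩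
  · intro z hz
    refine ⟨fun r => kleeneStar_mem_gammaDom (summable_single _ _),
      -- The shuffle product is the star of the sum of all letters, whose coefficients are all `1`.
      kleeneStar (letters (starLawLim fun r => z ^ (r : ℕ))), kleeneStar (letters 1),
      isInfiniteProduct_stuffle _, isInfiniteProduct_shuffle 1, ?_⟩
    obtain ⟨hsum, hval⟩ := gammaGen_starLawLim hz
    have hγ : gammaSeries (kleeneStar (letters (starLawLim fun r => z ^ (r : ℕ)))) =
        Complex.exp (ellSum z) := by rw [gammaSeries_kleeneStar hsum, hval]
    have hprod : HasProd (fun r : ℕ+ => Complex.exp (ell r z)) (Complex.exp (ellSum z)) :=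
      (hasSum_ell hz).cexp
    rw [hγ]
    refine ⟨⟨_, tendsto_gammaComponent hsum⟩, ?_, hprod, ?_, ?_⟩
    · simpa only [gammaSeries_single _ hz] using hprod
    · refine hprod.congr_fun fun r => ?_
      rw [GammaY, add_sub_cancel_left, Complex.exp_neg, one_div, inv_inv]
    · refine (hasSum_alphaWord hz).congr_fun fun w => ?_
      simp [kleeneStar_letters, Pi.one_def]
  · intro a b ha hb
    have ha' := kleeneStar_mem_gammaDom ha
    have hb' := kleeneStar_mem_gammaDom hb
    have hab := kleeneStar_mem_gammaDom (summable_starLaw ha hb)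
    exact ⟨ha', hb', hab, gammaSeries_starLaw ha' hb' hab⟩
  · intro r s c d
    have ha := kleeneStar_mem_gammaDom (summable_single s c)
    have hb := kleeneStar_mem_gammaDom (summable_single r d)
    have hab := kleeneStar_mem_gammaDom (summable_starLaw (summable_single s c) (summable_single r d))
    rw [← starLaw_single]
    exact ⟨hab, ha, hb, gammaSeries_starLaw ha hb hab⟩
  · intro s c
    have ha := kleeneStar_mem_gammaDom (summable_single s c)
    have hb := kleeneStar_mem_gammaDom (summable_single s (-c))
    have hab := kleeneStar_mem_gammaDom
      (summable_starLaw (summable_single s c) (summable_single s (-c)))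
    rw [← starLaw_single_neg]
    exact ⟨hab, ha, hb, gammaSeries_starLaw ha hb hab⟩
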